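/- Let $\mathcal X$ be a locally compact Polish space, with a fixed metric inducing its topology, and let $B_\delta(x)$ be the open ball of radius $\delta$ centred at $x$. Let $\mathcal M_1(\mathcal X)$ be the set of positive Radon measures on $\mathcal X$ of total mass at most $1$, with the vague topology, i.e. the weakest topology for which $\nu\mapsto\nu(f):=\int f\,d\nu$ is continuous for every continuous compactly supported $f:\mathcal X\to\mathbb R$. Let $\bar\mu$ be a Borel probability measure on $\mathcal X$ and $\tau:\mathcal X\to[0,+\infty]$ a Borel measurable function. Put $$\xi(x)=\sup_{\delta>0}\,\sup\{c\ge 0:\ \bar\mu(e^{c\tau}\mathbf 1_{B_\delta(x)})<+\infty\}\quad(x\in\mathcal X),\qquad \xi^\infty=\sup_{K\subset\mathcal X\text{ compact}}\ \sup\{c\ge 0:\ \bar\mu(e^{c\tau}\mathbf 1_{K^c})<+\infty\},$$ and assume that $\bar\mu(\{\tau=0\})=\bar\mu(\{\tau=+\infty\})=0$ and $\bar\mu(\{\xi<+\infty\})=0$. For $\nu\in\mathcal M_1(\mathcal X)$ let $\nu_a$ and $\nu_s$ be the absolutely continuous and singular parts of $\nu$ with respect to $\bar\mu$, and if $\nu_a(1/\tau)\in(0,+\infty)$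 let $\bar\nu_a$ be the probability measure $\bar\nu_a(dx)=\frac{1}{\nu_a(1/\tau)}\,\frac{1}{\tau(x)}\,\nu_a(dx)$. Let $\mathbf H(\cdot\,|\,\bar\mu)$ denote the relative entropy with respect to $\bar\mu$. Define $I':\mathcal M_1(\mathcal X)\to[0,+\infty]$ by $$I'(\nu)=\begin{cases}\nu_a(1/\tau)\,\mathbf H(\bar\nu_a|\bar\mu)+\nu_s(\xi)+(1-\nu(\mathcal X))\,\xi^\infty & \text{if }\nu_a(1/\tau)<+\infty,\\ +\infty&\text{otherwise,}\end{cases}$$ where $\nu_a(1/\tau)\,\mathbf H(\bar\nu_a|\bar\mu)=0$ if $\nu_a(1/\tau)=0$, and $0\cdot\infty=0$. Then $I'$ is good, i.e. $\{\nu\in\mathcal M_1(\mathcal X): I'(\nu)\le M\}$ is vaguely compact for every $M\in(0,+\infty)$ and $I'\not\equiv+\infty$; and $I'$ is convex, i.e. $I'(a\nu_1+b\nu_2)\le a\,I'(\nu_1)+b\,I'(\nu_2)$ for all $\nu_1,\nu_2\in\mathcal M_1(\mathcal X)$ and all $a,b\ge0$ with $a+b=1$. -/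

import Mathlib

open MeasureTheory Set
open scoped NNReal ENNReal CompactlySupported

namespace RenewalLD

noncomputable section

/-- The positive Borel measures on `X` of total mass at most `1`. On a Polish space every finite
Borel measure is Radon, so for Polish `X` these are the positive Radon measures of total variation
at most `1`. -/
def SubProb (X : Type*) [MeasurableSpace X] : Type _ :=
  {ν : Measure X // ν univ ≤ 1}

/-- The vague topology: the weakest topology such that `ν ↦ ∫ f dν` is continuous for every
compactly supported continuous `f : X → ℝ`. -/
instance SubProb.instTopologicalSpace (X : Type*) [TopologicalSpace X] [MeasurableSpace X] :
    TopologicalSpace (SubProb X) :=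
  ⨅ f : C_c(X, ℝ), TopologicalSpace.induced (fun ν : SubProb X => ∫ x, f x ∂ν.1) inferInstance

/-- The convex combination `a ν₁ + b ν₂`, where `a + b = 1`. -/
def SubProb.mix {X : Type*} [MeasurableSpace X] (a b : ℝ≥0) (hab : a + b = 1)
    (ν₁ ν₂ : SubProb X) : SubProb X :=
  ⟨a • ν₁.1 + b • ν₂.1, by
    have h1 : (a : ℝ≥0∞) * ν₁.1 univ ≤ a * 1 := mul_le_mul_right ν₁.2 _
    have h2 : (b : ℝ≥0∞) * ν₂.1 univ ≤ b * 1 := mul_le_mul_right ν₂.2 _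
    have h3 : (a : ℝ≥0∞) + b = 1 := by exact_mod_cast hab
    calc (a • ν₁.1 + b • ν₂.1) univ
        = (a : ℝ≥0∞) * ν₁.1 univ + (b : ℝ≥0∞) * ν₂.1 univ := by
          rw [Measure.add_apply, Measure.smul_apply, Measure.smul_apply]; rfl
      _ ≤ a * 1 + b * 1 := add_le_add h1 h2
      _ = 1 := by rw [mul_one, mul_one, h3]⟩

/-- `I` is convex: `I (a ν₁ + b ν₂) ≤ a I(ν₁) + b I(ν₂)` for `a, b ≥ 0`, `a + b = 1`
(with `0 * ∞ = 0`). -/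
def IsConvexFunctional {X : Type*} [MeasurableSpace X] (I : SubProb X → ℝ≥0∞) : Prop :=
  ∀ (ν₁ ν₂ : SubProb X) (a b : ℝ≥0) (hab : a + b = 1),
    I (SubProb.mix a b hab ν₁ ν₂) ≤ (a : ℝ≥0∞) * I ν₁ + (b : ℝ≥0∞) * I ν₂

/-- `I : Y → [0, ∞]` is good: all sublevel sets at levels `M ∈ (0, ∞)` are compact, and `I` is
not identically `∞`. -/
def IsGood {Y : Type*} [TopologicalSpace Y] (I : Y → ℝ≥0∞) : Prop :=
  (∀ M : ℝ≥0, 0 < M → IsCompact {y | I y ≤ (M : ℝ≥0∞)}) ∧ ∃ y, I y ≠ ∞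

/-- `sup {c ≥ 0 : μ(exp(c τ) 1_A) < ∞}`, an element of `[0, ∞]`. -/
def expRate {X : Type*} [MeasurableSpace X] (μ : Measure X) (τ : X → ℝ≥0∞) (A : Set X) : ℝ≥0∞ :=
  ⨆ (c : ℝ≥0) (_ : ∫⁻ x in A, EReal.exp (((c : ℝ≥0∞) * τ x : ℝ≥0∞) : EReal) ∂μ < ∞), (c : ℝ≥0∞)

/-- `ξ(x) = sup_{δ > 0} sup {c ≥ 0 : μ(exp(c τ) 1_{B_δ(x)}) < ∞}`. -/
def xi {X : Type*} [MetricSpace X] [MeasurableSpace X] (μ : Measure X) (τ : X → ℝ≥0∞) (x : X) :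
    ℝ≥0∞ :=
  ⨆ (δ : ℝ) (_ : 0 < δ), expRate μ τ (Metric.ball x δ)

/-- `ξ^∞ = sup_{K compact} sup {c ≥ 0 : μ(exp(c τ) 1_{Kᶜ}) < ∞}`. -/
def xiInfty {X : Type*} [TopologicalSpace X] [MeasurableSpace X] (μ : Measure X)
    (τ : X → ℝ≥0∞) : ℝ≥0∞ :=
  ⨆ (K : Set X) (_ : IsCompact K), expRate μ τ Kᶜ

/-- `ν_a`, the absolutely continuous part of `ν` with respect to `μ`. -/
def acPart {X : Type*} [MeasurableSpace X] (ν μ : Measure X) : Measure X :=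
  μ.withDensity (ν.rnDeriv μ)

/-- `ν(1/τ)`, with `1/0 = ∞` and `1/∞ = 0`. -/
def invTau {X : Type*} [MeasurableSpace X] (τ : X → ℝ≥0∞) (ν : Measure X) : ℝ≥0∞ :=
  ∫⁻ x, (τ x)⁻¹ ∂ν

/-- The probability measure `ν(dx) / (τ(x) ν(1/τ))`, of interest when `0 < ν(1/τ) < ∞`. -/
def tilt {X : Type*} [MeasurableSpace X] (τ : X → ℝ≥0∞) (ν : Measure X) : Measure X :=
  (invTau τ ν)⁻¹ • ν.withDensity (fun x => (τ x)⁻¹)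

open Classical in
/-- The functional `I'` on measures of mass at most `1`. The relative entropy is
`InformationTheory.klDiv`. Since `0 * ∞ = 0` in `[0, ∞]`, the first term vanishes when
`ν_a(1/τ) = 0`, and the last one vanishes when `ν` has mass `1`. -/
def rateI' {X : Type*} [MetricSpace X] [MeasurableSpace X] (μ : Measure X) (τ : X → ℝ≥0∞)
    (ν : SubProb X) : ℝ≥0∞ :=
  if invTau τ (acPart ν.1 μ) < ∞ then
    invTau τ (acPart ν.1 μ) * InformationTheory.klDiv (tilt τ (acPart ν.1 μ)) μ
      + ∫⁻ x, xi μ τ x ∂(ν.1.singularPart μ)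
      + (1 - ν.1 univ) * xiInfty μ τ
  else ∞

end

end RenewalLD

/-!
The functional `rateI'` is the supremum, over `f` continuous with compact support and `c` real such
that `μ(exp (τ (f + c))) ≤ 1`, of the functions `ν ↦ ν(f) + c` (`rateI'_le_iff_dualBound`). These are
vaguely continuous and affine, so the sublevel sets are vaguely closed and the functional is convex.
The space of measures of mass at most `1` is itself vaguely compact, by the Riesz–Markov–Kakutani
and Tychonoff theorems (`SubProb.compactSpace`). That `rateI'` is finite somewhere is seen at the
probability measure proportional to `τ 1_{τ ≤ n} μ`.

To see that the supremum is at most `rateI'`, write `ψ = f + c`, so that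
`ν(f) + c = ν_a(ψ) + ν_s(ψ) + c (1 - ν(X))`. The moment condition forces `ψ ≤ ξ` and `c ≤ ξ^∞`, and
Young's inequality `u φ ≤ (u log u + 1 - u) + (exp φ - 1)` with `φ = τ ψ` bounds `ν_a(ψ)` by the
entropy term (`dualBound_of_rateI'_le`).

For the converse (`rateI'_le_of_dualBound`), the class of test functions is enlarged. Below `ξ` the
weight `exp (τ ψ)` is locally integrable, so cutoffs, outer regularity and Lusin's theorem allow
bounded measurable `ψ < ξ`, together with any value `c < ξ^∞` at infinity
(`DualBound.integral_add_le`). Since `ν_s` lives on a `μ`-null set, the values of `ψ` there do not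
affect the moment condition, and since `ξ = ∞` almost everywhere, the values elsewhere are not
constrained by `ξ`; the two parts of `ν` may therefore be tested independently
(`DualBound.integral_acPart_add_le`). Test functions increasing to `ξ` on the null set give
`ν_s(ξ)`, constants increasing to `ξ^∞` give the last term, and test functions `φ / τ` with `φ` a
truncation of `log (dν̄_a/dμ)` give the entropy term, by the Donsker–Varadhan duality
(`invTau_mul_klDiv_le_of_forall`). The same argument with `φ = ±1` shows that `ν_a(1/τ)` is finite.
-/

open MeasureTheory Set
open scoped NNReal ENNReal CompactlySupported

namespace RenewalLD

/-! ### Vague compactness of the measures of mass at most `1` -/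

section Compactness

open Filter Topology

variable {X : Type*} [TopologicalSpace X]

/-- Positive linear functionals on `C_c(X, ℝ)` bounded by the supremum of the function. -/
def subunitFunctionals (X : Type*) [TopologicalSpace X] : Set (C_c(X, ℝ) → ℝ) :=
  {Λ | (∀ f g, Λ (f + g) = Λ f + Λ g) ∧ (∀ (r : ℝ) f, Λ (r • f) = r * Λ f) ∧
    (∀ f, (∀ x, 0 ≤ f x) → 0 ≤ Λ f) ∧ ∀ f (C : ℝ), 0 ≤ C → (∀ x, f x ≤ C) → Λ f ≤ C}

lemma isCompact_subunitFunctionals : IsCompact (subunitFunctionals X) := by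
  have hb : ∀ f : C_c(X, ℝ), ∃ C : ℝ, 0 ≤ C ∧ ∀ x, |f x| ≤ C := fun f => by
    obtain ⟨C, hC⟩ := f.hasCompactSupport.exists_bound_of_continuous f.continuous
    exact ⟨max C 0, le_max_right _ _, fun x => (hC x).trans (le_max_left _ _)⟩
  choose C hC0 hC using hb
  have hcomp : IsCompact (Set.pi univ fun f : C_c(X, ℝ) => Icc (-C f) (C f)) :=
    isCompact_univ_pi fun f => isCompact_Icc
  refine hcomp.of_isClosed_subset ?_ ?_
  · simp only [subunitFunctionals, ofPred_and, ofPred_forall]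
    refine IsClosed.inter ?_ (IsClosed.inter ?_ (IsClosed.inter ?_ ?_))
    · exact isClosed_iInter fun f => isClosed_iInter fun g =>
        isClosed_eq (continuous_apply _) ((continuous_apply f).add (continuous_apply g))
    · exact isClosed_iInter fun r => isClosed_iInter fun f =>
        isClosed_eq (continuous_apply _) (continuous_const.mul (continuous_apply _))
    · exact isClosed_iInter fun f => isClosed_iInter fun _ =>
        isClosed_le continuous_const (continuous_apply _)
    · exact isClosed_iInter fun f => isClosed_iInter fun B => isClosed_iInter fun _ =>
        isClosed_iInter fun _ => isClosed_le (continuous_apply _) continuous_const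
  · rintro Λ ⟨-, hsmul, -, hle⟩ f -
    refine ⟨?_, hle f _ (hC0 f) fun x => (abs_le.1 (hC f x)).2⟩
    have h := hle ((-1 : ℝ) • f) _ (hC0 f) fun x => by
      have := (abs_le.1 (hC f x)).1
      simp only [CompactlySupportedContinuousMap.smul_apply, smul_eq_mul]
      linarith
    rw [hsmul] at h
    linarith

variable [MeasurableSpace X]

instance SubProb.isFiniteMeasure (ν : SubProb X) : IsFiniteMeasure ν.1 :=
  ⟨ν.2.trans_lt ENNReal.one_lt_top⟩

/-- The functional `f ↦ ∫ f dν` on `C_c(X, ℝ)` defined by `ν`, as a point of a product space. -/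
noncomputable def SubProb.toFunctional (ν : SubProb X) : C_c(X, ℝ) → ℝ := fun f => ∫ x, f x ∂ν.1

lemma SubProb.isInducing_toFunctional :
    IsInducing (SubProb.toFunctional : SubProb X → C_c(X, ℝ) → ℝ) :=
  inducing_iInf_to_pi fun (f : C_c(X, ℝ)) (ν : SubProb X) => ∫ x, f x ∂ν.1

lemma SubProb.continuous_integral (f : C_c(X, ℝ)) :
    Continuous fun ν : SubProb X => ∫ x, f x ∂ν.1 :=
  (continuous_apply f).comp SubProb.isInducing_toFunctional.continuous

lemma integrable_compactlySupported [OpensMeasurableSpace X] (f : C_c(X, ℝ)) (ν : Measure X)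
    [IsFiniteMeasure ν] : Integrable f ν :=
  f.continuous.integrable_of_hasCompactSupport f.hasCompactSupport

lemma range_toFunctional [T2Space X] [LocallyCompactSpace X] [BorelSpace X] :
    range (SubProb.toFunctional : SubProb X → C_c(X, ℝ) → ℝ) = subunitFunctionals X := by
  refine Subset.antisymm ?_ ?_
  · rintro _ ⟨ν, rfl⟩
    refine ⟨fun f g => ?_, fun r f => ?_, fun f hf => integral_nonneg hf, fun f C hC hf => ?_⟩
    · exact integral_add (integrable_compactlySupported f _) (integrable_compactlySupported g _)
    · exact integral_const_mul r _
    · calc ∫ x, f x ∂ν.1 ≤ ∫ _, C ∂ν.1 :=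
            integral_mono (integrable_compactlySupported f _) (integrable_const _) hf
        _ = ν.1.real univ * C := by simp
        _ ≤ 1 * C := mul_le_mul_of_nonneg_right
            (ENNReal.toReal_le_of_le_ofReal zero_le_one (by simpa using ν.2)) hC
        _ = C := one_mul C
  · rintro Λ ⟨hadd, hsmul, hpos, hle⟩
    let L : C_c(X, ℝ) →ₚ[ℝ] ℝ := PositiveLinearMap.mk₀
      { toFun := Λ, map_add' := hadd, map_smul' := fun r f => hsmul r f } fun f hf => hpos f hf
    have hmass : RealRMK.rieszMeasure L univ ≤ 1 := by
      rw [isOpen_univ.measure_eq_iSup_isCompact]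
      refine iSup_le fun K => iSup_le fun _ => iSup_le fun hK => ?_
      obtain ⟨f, hf1, -, hfc, hf⟩ := exists_continuous_one_zero_of_isCompact hK isClosed_empty
        (disjoint_empty K)
      let F : C_c(X, ℝ) := ⟨f, hfc⟩
      refine (RealRMK.rieszMeasure_le_of_eq_one L (f := F) (fun x => (hf x).1) hK hf1).trans ?_
      exact ENNReal.ofReal_le_one.2 (hle F 1 zero_le_one fun x => (hf x).2)
    exact ⟨⟨RealRMK.rieszMeasure L, hmass⟩, funext fun f => RealRMK.integral_rieszMeasure L f⟩

/-- By the Riesz–Markov–Kakutani theorem the measures of mass at most `1` are all the positive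
functionals in the unit ball, so they form a vaguely compact set. -/
instance SubProb.compactSpace [T2Space X] [LocallyCompactSpace X] [BorelSpace X] :
    CompactSpace (SubProb X) := by
  refine ⟨?_⟩
  rw [SubProb.isInducing_toFunctional.isCompact_iff, image_univ, range_toFunctional]
  exact isCompact_subunitFunctionals

end Compactness

/-! ### Exponential moments and the rates `ξ`, `ξ^∞` -/

/-- The density `exp (τ ψ)`, for a real-valued `ψ`. Where `τ = ∞`, a null set in all uses, `τ` is
read as `0`. -/
noncomputable def expWeight {X : Type*} (τ : X → ℝ≥0∞) (ψ : X → ℝ) (x : X) : ℝ≥0∞ :=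
  ENNReal.ofReal (Real.exp ((τ x).toReal * ψ x))

lemma expWeight_mono {X : Type*} {τ : X → ℝ≥0∞} {φ ψ : X → ℝ} {x : X} (h : φ x ≤ ψ x) :
    expWeight τ φ x ≤ expWeight τ ψ x := by
  unfold expWeight
  gcongr

lemma expWeight_congr {X : Type*} {τ : X → ℝ≥0∞} {φ ψ : X → ℝ} {x : X} (h : φ x = ψ x) :
    expWeight τ φ x = expWeight τ ψ x := by
  simp only [expWeight, h]

lemma expWeight_of_eq_zero {X : Type*} {τ : X → ℝ≥0∞} {ψ : X → ℝ} {x : X} (h : ψ x = 0) :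
    expWeight τ ψ x = 1 := by
  simp [expWeight, h]

lemma measurable_expWeight {X : Type*} [MeasurableSpace X] {τ : X → ℝ≥0∞} (hτ : Measurable τ)
    {ψ : X → ℝ} (hψ : Measurable ψ) : Measurable (expWeight τ ψ) :=
  ((hτ.ennreal_toReal.mul hψ).exp).ennreal_ofReal

lemma exp_coe_mul_eq_expWeight {X : Type*} {τ : X → ℝ≥0∞} (c : ℝ≥0) {x : X} (hx : τ x ≠ ∞) :
    EReal.exp (((c : ℝ≥0∞) * τ x : ℝ≥0∞) : EReal) = expWeight τ (fun _ => (c : ℝ)) x := by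
  have h : (c : ℝ≥0∞) * τ x ≠ ∞ := ENNReal.mul_ne_top ENNReal.coe_ne_top hx
  rw [← ENNReal.ofReal_toReal h, EReal.coe_ennreal_ofReal, max_eq_left ENNReal.toReal_nonneg,
    EReal.exp_coe, ENNReal.toReal_mul, expWeight, mul_comm]
  rfl

section Rates

variable {X : Type*} [MeasurableSpace X] {μ : Measure X} {τ : X → ℝ≥0∞}

lemma lintegral_expWeight_lt_top_of_lt_expRate (hfin : ∀ᵐ x ∂μ, τ x ≠ ∞) {A : Set X} {c : ℝ≥0}
    (hc : (c : ℝ≥0∞) < expRate μ τ A) : ∫⁻ x in A, expWeight τ (fun _ => (c : ℝ)) x ∂μ < ∞ := by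
  simp only [expRate, lt_iSup_iff] at hc
  obtain ⟨c', hint, hcc'⟩ := hc
  refine lt_of_le_of_lt (lintegral_mono_ae ?_) hint
  filter_upwards [ae_restrict_of_ae hfin] with x hx
  rw [exp_coe_mul_eq_expWeight c' hx]
  exact expWeight_mono (NNReal.coe_le_coe.2 (ENNReal.coe_lt_coe.1 hcc').le)

lemma le_expRate (hfin : ∀ᵐ x ∂μ, τ x ≠ ∞) {A : Set X} {c : ℝ≥0}
    (hc : ∫⁻ x in A, expWeight τ (fun _ => (c : ℝ)) x ∂μ < ∞) : (c : ℝ≥0∞) ≤ expRate μ τ A := by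
  refine le_iSup₂_of_le (f := fun (c : ℝ≥0) _ => (c : ℝ≥0∞)) c ?_ le_rfl
  rwa [lintegral_congr_ae]
  filter_upwards [ae_restrict_of_ae hfin] with x hx using exp_coe_mul_eq_expWeight c hx

lemma expRate_anti {A B : Set X} (h : A ⊆ B) : expRate μ τ B ≤ expRate μ τ A :=
  iSup_mono fun _ => iSup_mono' fun hB => ⟨(lintegral_mono_set h).trans_lt hB, le_rfl⟩

lemma lowerSemicontinuous_xi {X : Type*} [MetricSpace X] [MeasurableSpace X] (μ : Measure X)
    (τ : X → ℝ≥0∞) : LowerSemicontinuous (xi μ τ) := by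
  intro x c hc
  simp only [xi, lt_iSup_iff] at hc
  obtain ⟨δ, hδ, hlt⟩ := hc
  filter_upwards [Metric.ball_mem_nhds x hδ] with y hy
  refine hlt.trans_le ((expRate_anti (Metric.ball_subset_ball' (ε₁ := δ - dist y x) ?_)).trans
    (le_iSup₂ (f := fun (δ : ℝ) (_ : 0 < δ) => expRate μ τ (Metric.ball y δ)) (δ - dist y x) ?_))
  · linarith
  · linarith [Metric.mem_ball.1 hy]

/-- A real `c ≥ 0` below the rate `ξ^∞` is an exponential moment off some compact set. The case
`c = 0` is allowed even if `ξ^∞ = 0`. -/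
lemma exists_compact_lintegral_expWeight_lt_top [TopologicalSpace X] [IsFiniteMeasure μ]
    (hfin : ∀ᵐ x ∂μ, τ x ≠ ∞) {c : ℝ≥0} (hc : c = 0 ∨ (c : ℝ≥0∞) < xiInfty μ τ) :
    ∃ L : Set X, IsCompact L ∧ ∫⁻ x in Lᶜ, expWeight τ (fun _ => (c : ℝ)) x ∂μ < ∞ := by
  rcases hc with rfl | hc
  · refine ⟨∅, isCompact_empty, ?_⟩
    simp [expWeight]
  · simp only [xiInfty, lt_iSup_iff] at hc
    obtain ⟨L, hL, hlt⟩ := hc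
    exact ⟨L, hL, lintegral_expWeight_lt_top_of_lt_expRate hfin hlt⟩

end Rates

/-! ### Enlarging the class of test functions in the dual bound -/

/-- The dual form of `rateI' μ τ ν ≤ M`: the bound `ν(f + c) + c (1 - ν(X)) ≤ M` for all functions
`f + c`, with `f` continuous and compactly supported and `c` constant, such that
`μ(exp (τ (f + c))) ≤ 1`. The left side is `ν(f) + c`, vaguely continuous and affine in `ν`. -/
def DualBound {X : Type*} [TopologicalSpace X] [MeasurableSpace X] (μ : Measure X) (τ : X → ℝ≥0∞)
    (ν : Measure X) (M : ℝ) : Prop :=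
  ∀ (f : C_c(X, ℝ)) (c : ℝ), ∫⁻ x, expWeight τ (fun x => f x + c) x ∂μ ≤ 1 →
    ∫ x, f x ∂ν + c ≤ M

section Enlarge

open Filter Topology

variable {X : Type*} [MetricSpace X] [MeasurableSpace X] [BorelSpace X]
  {μ : Measure X} {τ : X → ℝ≥0∞}

/-- Near a point where a continuous function is below `ξ`, its exponential weight is integrable. -/
lemma exists_nhds_lintegral_expWeight_lt_top (hfin : ∀ᵐ x ∂μ, τ x ≠ ∞) (g : C(X, ℝ)) {x : X}
    (hx : ENNReal.ofReal (g x) < xi μ τ x) :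
    ∃ U ∈ 𝓝 x, ∫⁻ y in U, expWeight τ (fun y => max (g y) 0) y ∂μ < ∞ := by
  obtain ⟨c, hgc, hcx⟩ := ENNReal.lt_iff_exists_nnreal_btwn.1 hx
  simp only [xi, lt_iSup_iff] at hcx
  obtain ⟨δ, hδ, hlt⟩ := hcx
  have hgc' : g x < c := by
    by_contra! h
    exact hgc.not_ge (by simpa using ENNReal.ofReal_le_ofReal h)
  refine ⟨Metric.ball x δ ∩ {y | g y < c}, inter_mem (Metric.ball_mem_nhds x hδ)
    ((isOpen_lt g.continuous continuous_const).mem_nhds hgc'), ?_⟩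
  have hmeas : MeasurableSet (Metric.ball x δ ∩ {y | g y < c}) :=
    Metric.isOpen_ball.measurableSet.inter (isOpen_lt g.continuous continuous_const).measurableSet
  calc _ ≤ ∫⁻ y in Metric.ball x δ ∩ {y | g y < c}, expWeight τ (fun _ => (c : ℝ)) y ∂μ :=
        setLIntegral_mono' hmeas fun y hy => expWeight_mono (max_le hy.2.le c.2)
    _ ≤ _ := lintegral_mono_set inter_subset_left
    _ < ∞ := lintegral_expWeight_lt_top_of_lt_expRate hfin hlt

variable [PolishSpace X] {ν : Measure X} [IsFiniteMeasure ν] {M : ℝ}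

/-- The dual bound extends to the discontinuous test functions `g 1_K` with `K` compact and `g`
continuous and below `ξ` on `K`, taking the value `c` at infinity. -/
theorem DualBound.setIntegral_add_le [LocallyCompactSpace X] (hJ : DualBound μ τ ν M)
    (hτ : Measurable τ) (hfin : ∀ᵐ x ∂μ, τ x ≠ ∞)
    {K : Set X} (hK : IsCompact K) (g : C(X, ℝ)) (hg : ∀ x ∈ K, ENNReal.ofReal (g x) < xi μ τ x)
    {c : ℝ≥0} {L : Set X} (hL : IsCompact L)
    (hcL : ∫⁻ x in Lᶜ, expWeight τ (fun _ => (c : ℝ)) x ∂μ < ∞)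
    (hlt : ∫⁻ x in K, expWeight τ g x ∂μ + μ Kᶜ < 1) :
    ∫ x in K, g x ∂ν + c * (1 - ν.real univ) ≤ M := by
  refine le_of_forall_pos_le_add fun ε hε => ?_
  obtain ⟨η, hη0, hη1, hηε⟩ : ∃ η : ℝ≥0∞, 0 < η ∧
      (∫⁻ x in K, expWeight τ g x ∂μ + μ Kᶜ) + (η + η) ≤ 1 ∧ η ≤ ENNReal.ofReal ε := by
    refine ⟨min ((1 - (∫⁻ x in K, expWeight τ g x ∂μ + μ Kᶜ)) / 2) (ENNReal.ofReal ε),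
      lt_min (ENNReal.half_pos (tsub_pos_of_lt hlt).ne') (ENNReal.ofReal_pos.2 hε), ?_,
      min_le_right _ _⟩
    calc _ ≤ (∫⁻ x in K, expWeight τ g x ∂μ + μ Kᶜ) +
          ((1 - (∫⁻ x in K, expWeight τ g x ∂μ + μ Kᶜ)) / 2 +
            (1 - (∫⁻ x in K, expWeight τ g x ∂μ + μ Kᶜ)) / 2) := by
          gcongr <;> exact min_le_left _ _
      _ = 1 := by rw [ENNReal.add_halves, add_tsub_cancel_of_le hlt.le]
  have hgm : Measurable g := g.continuous.measurable
  have hg0m : Measurable fun x => max (g x) 0 := hgm.max measurable_const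
  have hw1 : Measurable (expWeight τ fun x => max (g x) 0) := measurable_expWeight hτ hg0m
  set m : Measure X := μ.withDensity (expWeight τ fun x => max (g x) 0) +
    ν.withDensity (fun x => ENNReal.ofReal |g x|) with hm
  -- `m` controls both the exponential moments and the integrals in a neighbourhood of `K`
  have hmfin : ∀ x ∈ K, m.FiniteAtFilter (𝓝 x) := by
    intro x hx
    obtain ⟨U, hU, hUfin⟩ := exists_nhds_lintegral_expWeight_lt_top hfin g (hg x hx)
    have hV : {y | |g y| < |g x| + 1} ∈ 𝓝 x :=
      (isOpen_lt g.continuous.abs continuous_const).mem_nhds (by simp)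
    have hVm : MeasurableSet {y | |g y| < |g x| + 1} :=
      (isOpen_lt g.continuous.abs continuous_const).measurableSet
    refine ⟨interior U ∩ {y | |g y| < |g x| + 1}, inter_mem (interior_mem_nhds.2 hU) hV, ?_⟩
    have hWm : MeasurableSet (interior U ∩ {y | |g y| < |g x| + 1}) :=
      isOpen_interior.measurableSet.inter hVm
    rw [hm, Measure.add_apply, withDensity_apply _ hWm, withDensity_apply _ hWm]
    refine ENNReal.add_lt_top.2 ⟨(lintegral_mono_set
      (inter_subset_left.trans interior_subset)).trans_lt hUfin, ?_⟩
    calc _ ≤ ∫⁻ y in interior U ∩ {y | |g y| < |g x| + 1}, ENNReal.ofReal (|g x| + 1) ∂ν :=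
          setLIntegral_mono' hWm fun y hy => ENNReal.ofReal_le_ofReal (le_of_lt hy.2)
      _ < ∞ := by
          rw [setLIntegral_const]
          exact ENNReal.mul_lt_top ENNReal.ofReal_lt_top (measure_lt_top _ _)
  obtain ⟨U, hKU, hUo, hUfin⟩ := hK.exists_open_superset_measure_lt_top' hmfin
  have : IsFiniteMeasure (m.restrict U) := ⟨by simpa using hUfin⟩
  obtain ⟨V, hKV, hVo, -, hVη⟩ := hK.measurableSet.exists_isOpen_sdiff_lt
    (μ := m.restrict U) (measure_ne_top _ _) hη0.ne'
  obtain ⟨W, hWo, hKW, hWη⟩ : ∃ W, IsOpen W ∧ K ⊆ W ∧ m (W \ K) < η := by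
    refine ⟨V ∩ U, hVo.inter hUo, subset_inter hKV hKU, ?_⟩
    rw [Measure.restrict_apply (hVo.measurableSet.diff hK.measurableSet)] at hVη
    convert! hVη using 2
    ext x
    simp only [Set.mem_sdiff, mem_inter_iff]
    tauto
  have hWKm : MeasurableSet (W \ K) := hWo.measurableSet.diff hK.measurableSet
  rw [hm, Measure.add_apply, withDensity_apply _ hWKm, withDensity_apply _ hWKm] at hWη
  obtain ⟨χ, hχ1, hχ0, hχc, hχ⟩ := exists_continuous_one_zero_of_isCompact hK
    hWo.isClosed_compl (disjoint_compl_right_iff_subset.2 hKW)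
  -- a compact set off which the contribution of the value at infinity is negligible
  have : IsFiniteMeasure ((μ.withDensity (expWeight τ fun _ => (c : ℝ))).restrict Lᶜ) := by
    refine ⟨?_⟩
    rw [Measure.restrict_apply_univ, withDensity_apply _ hL.measurableSet.compl]
    exact hcL
  obtain ⟨L', -, hL', hL'η⟩ := MeasurableSet.univ.exists_isCompact_sdiff_lt
    (μ := (μ.withDensity (expWeight τ fun _ => (c : ℝ))).restrict Lᶜ) (measure_ne_top _ _) hη0.ne'
  obtain ⟨Q, hQc, hχQ, hQη⟩ : ∃ Q, IsCompact Q ∧ tsupport χ ⊆ Q ∧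
      ∫⁻ x in Qᶜ, expWeight τ (fun _ => (c : ℝ)) x ∂μ < η := by
    have hQ : IsCompact (L ∪ L' ∪ tsupport χ) := (hL.union hL').union hχc
    refine ⟨_, hQ, subset_union_right, lt_of_le_of_lt ?_ hL'η⟩
    rw [Measure.restrict_apply (MeasurableSet.univ.diff hL'.measurableSet),
      withDensity_apply _ ((MeasurableSet.univ.diff hL'.measurableSet).inter
        hL.measurableSet.compl)]
    refine lintegral_mono_set fun x hx => ?_
    simp only [mem_compl_iff, mem_union, not_or] at hx
    exact ⟨⟨mem_univ x, hx.1.2⟩, hx.1.1⟩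
  obtain ⟨κ, hκ1, -, hκc, hκ⟩ := exists_continuous_one_zero_of_isCompact hQc
    isClosed_empty (disjoint_empty Q)
  let f : C_c(X, ℝ) := ⟨g * χ - (c : ℝ) • κ, by
    have h1 : HasCompactSupport (⇑g * ⇑χ) := hχc.mul_left
    have h2 : HasCompactSupport ((c : ℝ) • ⇑κ) := hκc.smul_left
    exact h1.sub h2⟩
  have hf : ∀ x, f x = g x * χ x - c * κ x := fun x => rfl
  have hχout : ∀ x, x ∉ Q → χ x = 0 := fun x hx => image_eq_zero_of_notMem_tsupport fun h => hx (hχQ h)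
  have hKQ : K ⊆ Q := fun x hx => by
    by_contra h
    have h1 := hχ1 hx
    rw [hχout x h] at h1
    exact zero_ne_one h1
  have hfeas : ∫⁻ x, expWeight τ (fun x => f x + c) x ∂μ ≤ 1 := by
    calc ∫⁻ x, expWeight τ (fun x => f x + c) x ∂μ
        ≤ ∫⁻ x, (K.indicator (expWeight τ g) x + Kᶜ.indicator 1 x) +
          ((W \ K).indicator (expWeight τ fun x => max (g x) 0) x +
            Qᶜ.indicator (expWeight τ fun _ => (c : ℝ)) x) ∂μ := by
          refine lintegral_mono fun x => ?_
          by_cases hxK : x ∈ K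
          · have h1 : χ x = 1 := hχ1 hxK
            have h2 : κ x = 1 := hκ1 (hKQ hxK)
            rw [indicator_of_mem hxK]
            refine (expWeight_congr ?_).le.trans (le_self_add.trans le_self_add)
            simp only [hf, h1, h2]; ring
          by_cases hxQ : x ∈ Q
          · have h2 : κ x = 1 := hκ1 hxQ
            have h3 : f x + c = g x * χ x := by rw [hf, h2]; ring
            by_cases hxW : x ∈ W
            · rw [indicator_of_mem (show x ∈ W \ K from ⟨hxW, hxK⟩)]
              refine (expWeight_mono ?_).trans (le_self_add.trans le_add_self)
              rw [h3]
              rcases le_total (g x) 0 with h | h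
              · exact (mul_nonpos_of_nonpos_of_nonneg h (hχ x).1).trans (le_max_right _ _)
              · exact (mul_le_of_le_one_right h (hχ x).2).trans (le_max_left _ _)
            · have h4 : χ x = 0 := hχ0 hxW
              rw [expWeight_of_eq_zero (by rw [h3, h4, mul_zero]),
                indicator_of_mem (show x ∈ Kᶜ from hxK)]
              exact le_add_self.trans le_self_add
          · rw [indicator_of_mem (show x ∈ Qᶜ from hxQ)]
            refine (expWeight_mono ?_).trans (le_add_self.trans le_add_self)
            rw [hf, hχout x hxQ]
            have := mul_nonneg c.2 (hκ x).1
            change 0 ≤ (c : ℝ) * κ x at this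
            linarith
      _ = (∫⁻ x in K, expWeight τ g x ∂μ + μ Kᶜ) +
          (∫⁻ x in W \ K, expWeight τ (fun x => max (g x) 0) x ∂μ +
            ∫⁻ x in Qᶜ, expWeight τ (fun _ => (c : ℝ)) x ∂μ) := by
          have e1 := (measurable_expWeight hτ hgm).indicator hK.measurableSet
          have e2 : Measurable (Kᶜ.indicator (1 : X → ℝ≥0∞)) :=
            measurable_one.indicator hK.measurableSet.compl
          have e3 := hw1.indicator hWKm
          have e12 : Measurable fun x => K.indicator (expWeight τ g) x + Kᶜ.indicator 1 x :=
            e1.add e2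
          rw [lintegral_add_left e12, lintegral_add_left e1, lintegral_add_left e3,
            lintegral_indicator hK.measurableSet, lintegral_indicator hWKm,
            lintegral_indicator hQc.measurableSet.compl,
            lintegral_indicator_one hK.measurableSet.compl]
      _ ≤ (∫⁻ x in K, expWeight τ g x ∂μ + μ Kᶜ) + (η + η) := by
          gcongr
          exact le_self_add.trans hWη.le
      _ ≤ 1 := hη1
  have hbound := hJ f c hfeas
  have hgK : IntegrableOn g K ν := g.continuous.continuousOn.integrableOn_compact hK
  have hgWη : ∫⁻ x in W \ K, ENNReal.ofReal |g x| ∂ν ≤ ENNReal.ofReal ε :=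
    (le_add_self.trans hWη.le).trans hηε
  have hgW : IntegrableOn (fun x => |g x|) (W \ K) ν := by
    refine ⟨hgm.abs.aestronglyMeasurable, ?_⟩
    rw [hasFiniteIntegral_iff_ofReal (ae_of_all _ fun x => abs_nonneg _)]
    exact hgWη.trans_lt ENNReal.ofReal_lt_top
  have hgWle : ∫ x in W \ K, |g x| ∂ν ≤ ε := by
    rw [integral_eq_lintegral_of_nonneg_ae (ae_of_all _ fun x => abs_nonneg _)
      hgm.abs.aestronglyMeasurable]
    exact ENNReal.toReal_le_of_le_ofReal hε.le hgWη
  have hfν : ∫ x in K, g x ∂ν - ∫ x in W \ K, |g x| ∂ν - c * ν.real univ ≤ ∫ x, f x ∂ν := by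
    have i1 : Integrable (K.indicator g) ν := hgK.integrable_indicator hK.measurableSet
    have i2 : Integrable ((W \ K).indicator fun x => |g x|) ν := hgW.integrable_indicator hWKm
    have i12 : Integrable (fun x => K.indicator g x - (W \ K).indicator (fun x => |g x|) x) ν :=
      i1.sub i2
    calc ∫ x in K, g x ∂ν - ∫ x in W \ K, |g x| ∂ν - c * ν.real univ
        = ∫ x, (K.indicator g x - (W \ K).indicator (fun x => |g x|) x - c) ∂ν := by
          rw [integral_sub i12 (integrable_const _), integral_sub i1 i2,
            integral_indicator hK.measurableSet, integral_indicator hWKm, integral_const,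
            smul_eq_mul, mul_comm (c : ℝ)]
      _ ≤ ∫ x, f x ∂ν := by
          refine integral_mono (i12.sub (integrable_const _))
            (integrable_compactlySupported f ν) fun x => ?_
          have hcκ : (c : ℝ) * κ x ≤ c := mul_le_of_le_one_right c.2 (hκ x).2
          simp only [hf]
          by_cases hxK : x ∈ K
          · have h1 : χ x = 1 := hχ1 hxK
            rw [indicator_of_mem hxK, indicator_of_notMem (fun h => h.2 hxK), h1]
            linarith
          rw [indicator_of_notMem hxK]
          by_cases hxW : x ∈ W
          · rw [indicator_of_mem (show x ∈ W \ K from ⟨hxW, hxK⟩)]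
            have h1 : |g x * χ x| ≤ |g x| := by
              rw [abs_mul, abs_of_nonneg (hχ x).1]
              exact mul_le_of_le_one_right (abs_nonneg _) (hχ x).2
            linarith [(abs_le.1 h1).1]
          · have h1 : χ x = 0 := hχ0 hxW
            rw [indicator_of_notMem (fun h => hxW h.1), h1]
            linarith
  linarith

variable [IsProbabilityMeasure μ]

/-- **Lusin's theorem** for a bounded function: it is continuous on a compact subset, of nearly full
measure, of any measurable set. -/
lemma exists_isCompact_continuousOn {m : Measure X} [IsFiniteMeasure m] {ψ : X → ℝ}
    (hψ : Measurable ψ) {C : ℝ} (hC : ∀ x, |ψ x| ≤ C) {B : Set X} (hB : MeasurableSet B)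
    {ε : ℝ≥0∞} (hε : 0 < ε) :
    ∃ K ⊆ B, IsCompact K ∧ m (B \ K) < ε ∧ ContinuousOn ψ K := by
  obtain ⟨r, hr, hrε⟩ : ∃ r : ℝ, 0 < r ∧ ENNReal.ofReal r < ε := by
    obtain ⟨r, hr0, hr⟩ := ENNReal.lt_iff_exists_nnreal_btwn.1 hε
    exact ⟨r, by exact_mod_cast hr0, by simpa using hr⟩
  have hL1 : MemLp ψ 1 m := MemLp.of_bound hψ.aestronglyMeasurable C (ae_of_all _ hC)
  have happ : ∀ n : ℕ, ∃ g : BoundedContinuousFunction X ℝ,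
      eLpNorm (ψ - (g : X → ℝ)) 1 m ≤ ENNReal.ofReal (1 / (n + 1)) := fun n => by
    obtain ⟨g, hg, -⟩ := hL1.exists_boundedContinuous_eLpNorm_sub_le ENNReal.one_ne_top
      (ε := ENNReal.ofReal (1 / (n + 1))) (ENNReal.ofReal_pos.2 (by positivity)).ne'
    exact ⟨g, hg⟩
  choose g hg using happ
  have hlim : TendstoInMeasure m (fun n => ⇑(g n)) atTop ψ := by
    refine tendstoInMeasure_of_tendsto_eLpNorm one_ne_zero
      (fun n => (g n).continuous.aestronglyMeasurable) hψ.aestronglyMeasurable ?_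
    have h0 : Tendsto (fun n : ℕ => ENNReal.ofReal (1 / ((n : ℝ) + 1))) atTop (𝓝 0) := by
      simpa using ENNReal.tendsto_ofReal tendsto_one_div_add_atTop_nhds_zero_nat
    refine tendsto_of_tendsto_of_tendsto_of_le_of_le tendsto_const_nhds h0
      (fun n => zero_le) fun n => ?_
    rw [← eLpNorm_neg, neg_sub]
    exact hg n
  obtain ⟨ns, -, hns⟩ := hlim.exists_seq_tendsto_ae
  obtain ⟨t, ht, htr, hunif⟩ := tendstoUniformlyOn_of_ae_tendsto'
    (fun n => (g (ns n)).continuous.stronglyMeasurable) hψ.stronglyMeasurable hns hr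
  have hcont : ContinuousOn ψ tᶜ :=
    hunif.continuousOn (Frequently.of_forall fun n => (g (ns n)).continuous.continuousOn)
  obtain ⟨K, hK, hKc, hKlt⟩ := (hB.diff ht).exists_isCompact_sdiff_lt (measure_ne_top m _)
    (tsub_pos_of_lt hrε).ne'
  refine ⟨K, hK.trans sdiff_subset, hKc, ?_, hcont.mono fun x hx => (hK hx).2⟩
  calc m (B \ K) ≤ m ((B \ t) \ K ∪ t) := measure_mono fun x hx => by
        by_cases hxt : x ∈ t
        · exact Or.inr hxt
        · exact Or.inl ⟨⟨hx.1, hxt⟩, hx.2⟩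
    _ ≤ m ((B \ t) \ K) + m t := measure_union_le _ _
    _ < (ε - ENNReal.ofReal r) + ENNReal.ofReal r :=
        ENNReal.add_lt_add_of_lt_of_le (measure_ne_top m _) hKlt htr
    _ = ε := tsub_add_cancel_of_le hrε.le

/-- The dual bound extends to bounded measurable test functions below `ξ`, taking the value `c` at
infinity. -/
theorem DualBound.integral_add_le [LocallyCompactSpace X] (hJ : DualBound μ τ ν M)
    (hτ : Measurable τ) (hfin : ∀ᵐ x ∂μ, τ x ≠ ∞)
    {ψ : X → ℝ} (hψ : Measurable ψ) {C : ℝ} (hC : ∀ x, |ψ x| ≤ C)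
    (hμξ : ∀ᵐ x ∂μ, ENNReal.ofReal (ψ x) < xi μ τ x)
    (hνξ : ∀ᵐ x ∂ν, ψ x ≠ 0 → ENNReal.ofReal (ψ x) < xi μ τ x)
    (hlt : ∫⁻ x, expWeight τ ψ x ∂μ < 1)
    {c : ℝ≥0} {L : Set X} (hL : IsCompact L)
    (hcL : ∫⁻ x in Lᶜ, expWeight τ (fun _ => (c : ℝ)) x ∂μ < ∞) :
    ∫ x, ψ x ∂ν + c * (1 - ν.real univ) ≤ M := by
  obtain ⟨x₀⟩ : Nonempty X := nonempty_of_isProbabilityMeasure μ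
  have hC0 : 0 ≤ C := (abs_nonneg _).trans (hC x₀)
  refine le_of_forall_pos_le_add fun ε hε => ?_
  set B : Set X := {x | ENNReal.ofReal (ψ x) < xi μ τ x} with hBdef
  have hB : MeasurableSet B :=
    measurableSet_lt hψ.ennreal_ofReal (lowerSemicontinuous_xi μ τ).measurable
  have hδ : 0 < min (1 - ∫⁻ x, expWeight τ ψ x ∂μ) (ENNReal.ofReal (ε / (C + 1))) :=
    lt_min (tsub_pos_of_lt hlt) (ENNReal.ofReal_pos.2 (by positivity))
  obtain ⟨K, hKB, hK, hKδ, hcont⟩ := exists_isCompact_continuousOn (m := μ + ν) hψ hC hB hδ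
  have hμK : μ (B \ K) < 1 - ∫⁻ x, expWeight τ ψ x ∂μ :=
    lt_of_le_of_lt (by simp) (hKδ.trans_le (min_le_left _ _))
  have hνK : ν (B \ K) ≤ ENNReal.ofReal (ε / (C + 1)) :=
    le_trans (by simp) (hKδ.le.trans (min_le_right _ _))
  obtain ⟨g, hg⟩ := ContinuousMap.exists_restrict_eq hK.isClosed
    ⟨K.domRestrict ψ, continuousOn_iff_continuous_domRestrict.1 hcont⟩
  have hgψ : ∀ x ∈ K, g x = ψ x := fun x hx => DFunLike.congr_fun hg ⟨x, hx⟩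
  have hμKc : μ Kᶜ ≤ μ (B \ K) := by
    refine measure_mono_ae ?_
    filter_upwards [hμξ] with x hx hxK using ⟨hx, hxK⟩
  have hmain := hJ.setIntegral_add_le hτ hfin hK g
    (fun x hx => by rw [hgψ x hx]; exact hKB hx) hL hcL (by
      calc ∫⁻ x in K, expWeight τ g x ∂μ + μ Kᶜ
          ≤ ∫⁻ x, expWeight τ ψ x ∂μ + μ (B \ K) := by
            refine add_le_add ?_ hμKc
            rw [setLIntegral_congr_fun hK.measurableSet
              fun x hx => expWeight_congr (τ := τ) (hgψ x hx)]
            exact setLIntegral_le_lintegral _ _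
        _ < ∫⁻ x, expWeight τ ψ x ∂μ + (1 - ∫⁻ x, expWeight τ ψ x ∂μ) :=
            ENNReal.add_lt_add_left hlt.ne_top hμK
        _ = 1 := add_tsub_cancel_of_le hlt.le)
  rw [setIntegral_congr_fun hK.measurableSet hgψ] at hmain
  have hψi : Integrable ψ ν := Integrable.of_bound hψ.aestronglyMeasurable C (ae_of_all _ hC)
  have hrest : ∫ x in Kᶜ, ψ x ∂ν ≤ ε := by
    have hBK : MeasurableSet (B \ K) := hB.diff hK.measurableSet
    calc ∫ x in Kᶜ, ψ x ∂ν = ∫ x, Kᶜ.indicator ψ x ∂ν :=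
          (integral_indicator hK.measurableSet.compl).symm
      _ ≤ ∫ x, (B \ K).indicator (fun _ => C) x ∂ν := by
          refine integral_mono_ae (hψi.indicator hK.measurableSet.compl)
            ((integrable_const C).indicator hBK) ?_
          filter_upwards [hνξ] with x hx
          by_cases hxK : x ∈ K
          · rw [indicator_of_notMem (not_not.2 hxK), indicator_of_notMem fun h => h.2 hxK]
          rw [indicator_of_mem (show x ∈ Kᶜ from hxK)]
          by_cases h0 : ψ x = 0
          · rw [h0]
            exact indicator_nonneg (fun _ _ => hC0) x
          · rw [indicator_of_mem (show x ∈ B \ K from ⟨hx h0, hxK⟩)]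
            exact (le_abs_self _).trans (hC x)
      _ = ν.real (B \ K) * C := by rw [integral_indicator hBK, setIntegral_const, smul_eq_mul]
      _ ≤ ε / (C + 1) * C := by
          gcongr
          exact ENNReal.toReal_le_of_le_ofReal (by positivity) hνK
      _ ≤ ε := by
          rw [div_mul_eq_mul_div, div_le_iff₀ (by positivity)]
          nlinarith
  rw [← integral_add_compl hK.measurableSet hψi]
  linarith

/-- The dual bound with independent test functions for the absolutely continuous and the singular
part. Since `ξ = ∞` almost everywhere, only the latter is constrained by `ξ`. -/
theorem DualBound.integral_acPart_add_le [LocallyCompactSpace X] (hJ : DualBound μ τ ν M)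
    (hτ : Measurable τ) (hfin : ∀ᵐ x ∂μ, τ x ≠ ∞) (hξ : ∀ᵐ x ∂μ, xi μ τ x = ∞)
    {ψ : X → ℝ} (hψ : Measurable ψ) {C : ℝ} (hC : ∀ x, |ψ x| ≤ C)
    (hlt : ∫⁻ x, expWeight τ ψ x ∂μ < 1)
    {θ : X → ℝ} (hθ : Measurable θ) {D : ℝ} (hD : ∀ x, |θ x| ≤ D)
    (hθξ : ∀ x, θ x ≠ 0 → ENNReal.ofReal (θ x) < xi μ τ x)
    {c : ℝ≥0} {L : Set X} (hL : IsCompact L)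
    (hcL : ∫⁻ x in Lᶜ, expWeight τ (fun _ => (c : ℝ)) x ∂μ < ∞) :
    ∫ x, ψ x ∂(acPart ν μ) + ∫ x, θ x ∂(ν.singularPart μ) + c * (1 - ν.real univ) ≤ M := by
  have hms := ν.mutuallySingular_singularPart μ
  have hNm : MeasurableSet hms.nullSet := hms.measurableSet_nullSet
  have hdec : ν = ν.singularPart μ + acPart ν μ := ν.haveLebesgueDecomposition_add μ
  have hac : acPart ν μ ≪ μ := withDensity_absolutelyContinuous _ _
  classical
  set φ : X → ℝ := hms.nullSet.piecewise ψ θ with hφ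
  have hφμ : ∀ᵐ x ∂μ, φ x = ψ x := by
    have h : ∀ᵐ x ∂μ, x ∈ hms.nullSet := hms.measure_compl_nullSet
    filter_upwards [h] with x hx using piecewise_eq_of_mem _ _ _ hx
  have hφs : ∀ᵐ x ∂(ν.singularPart μ), φ x = θ x := by
    have h : ∀ᵐ x ∂(ν.singularPart μ), x ∉ hms.nullSet :=
      measure_eq_zero_iff_ae_notMem.1 hms.measure_nullSet
    filter_upwards [h] with x hx using piecewise_eq_of_notMem _ _ _ hx
  have hφm : Measurable φ := hψ.piecewise hNm hθ
  have hφb : ∀ x, |φ x| ≤ max C D := fun x => by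
    by_cases hx : x ∈ hms.nullSet
    · rw [hφ, piecewise_eq_of_mem _ _ _ hx]
      exact (hC x).trans (le_max_left _ _)
    · rw [hφ, piecewise_eq_of_notMem _ _ _ hx]
      exact (hD x).trans (le_max_right _ _)
  have hφξ : ∀ᵐ x ∂μ, ENNReal.ofReal (φ x) < xi μ τ x := by
    filter_upwards [hξ] with x hx
    rw [hx]
    exact ENNReal.ofReal_lt_top
  have hmain := hJ.integral_add_le hτ hfin hφm hφb hφξ (by
      rw [hdec, ae_add_measure_iff]
      refine ⟨?_, ?_⟩
      · filter_upwards [hφs] with x hx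
        rw [hx]
        exact hθξ x
      · filter_upwards [hac.ae_le hφξ] with x hx _ using hx) (by
      rwa [lintegral_congr_ae (hφμ.mono fun x hx => expWeight_congr hx)]) hL hcL
  have hφi : ∀ ρ : Measure X, [IsFiniteMeasure ρ] → Integrable φ ρ := fun ρ _ =>
    Integrable.of_bound hφm.aestronglyMeasurable _ (ae_of_all _ hφb)
  have : IsFiniteMeasure (acPart ν μ) := by
    unfold acPart
    infer_instance
  have hsplit : ∫ x, φ x ∂ν = ∫ x, θ x ∂(ν.singularPart μ) + ∫ x, ψ x ∂(acPart ν μ) := by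
    calc ∫ x, φ x ∂ν = ∫ x, φ x ∂(ν.singularPart μ + acPart ν μ) := by rw [← hdec]
      _ = _ := by
        rw [integral_add_measure (hφi _) (hφi _), integral_congr_ae hφs,
          integral_congr_ae (hac.ae_le hφμ)]
  rw [hsplit] at hmain
  linarith

end Enlarge

/-! ### Duality for the relative entropy -/

section Entropy

open Filter Topology InformationTheory

variable {X : Type*} [MeasurableSpace X] {μ : Measure X} [IsProbabilityMeasure μ]
  {τ : X → ℝ≥0∞} {ρ : Measure X}

/-- Young's inequality for the conjugate pair `klFun` and `exp - 1`. -/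
lemma mul_le_klFun_add_exp_sub_one {u : ℝ} (hu : 0 ≤ u) (φ : ℝ) :
    u * φ ≤ klFun u + (Real.exp φ - 1) := by
  rcases hu.eq_or_lt with rfl | hu
  · simpa [klFun] using (Real.exp_pos φ).le
  · have h := mul_le_mul_of_nonneg_left (Real.add_one_le_exp (φ - Real.log u)) hu.le
    rw [Real.exp_sub, Real.exp_log hu, mul_div_cancel₀ _ hu.ne'] at h
    rw [klFun]
    linarith

/-- The easy half of the Donsker–Varadhan duality. -/
lemma integral_le_toReal_klDiv {κ : Measure X} [IsProbabilityMeasure κ] (hκ : κ ≪ μ)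
    (hkl : klDiv κ μ ≠ ∞) {φ : X → ℝ} (hφ : Measurable φ) (hφi : Integrable φ κ)
    (hexp : ∫⁻ x, ENNReal.ofReal (Real.exp (φ x)) ∂μ ≤ 1) : ∫ x, φ x ∂κ ≤ (klDiv κ μ).toReal := by
  have hklint : Integrable (fun x => klFun (κ.rnDeriv μ x).toReal) μ :=
    (integrable_klFun_rnDeriv_iff hκ).2 (klDiv_ne_top_iff.1 hkl).2
  have hexpint : Integrable (fun x => Real.exp (φ x)) μ := by
    refine ⟨hφ.exp.aestronglyMeasurable, ?_⟩
    rw [hasFiniteIntegral_iff_ofReal (ae_of_all _ fun x => (Real.exp_pos _).le)]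
    exact hexp.trans_lt ENNReal.one_lt_top
  have hexp1 : ∫ x, Real.exp (φ x) ∂μ ≤ 1 := by
    rw [integral_eq_lintegral_of_nonneg_ae (ae_of_all _ fun x => (Real.exp_pos _).le)
      hφ.exp.aestronglyMeasurable]
    exact ENNReal.toReal_le_of_le_ofReal zero_le_one (by simpa using hexp)
  have hsub : Integrable (fun x => Real.exp (φ x) - 1) μ := hexpint.sub (integrable_const _)
  rw [toReal_klDiv_eq_integral_klFun hκ, ← integral_rnDeriv_smul hκ]
  calc ∫ x, (κ.rnDeriv μ x).toReal • φ x ∂μ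
      ≤ ∫ x, (klFun (κ.rnDeriv μ x).toReal + (Real.exp (φ x) - 1)) ∂μ :=
        integral_mono ((integrable_rnDeriv_smul_iff hκ).2 hφi) (hklint.add hsub)
          fun x => mul_le_klFun_add_exp_sub_one ENNReal.toReal_nonneg _
    _ = ∫ x, klFun (κ.rnDeriv μ x).toReal ∂μ + (∫ x, Real.exp (φ x) ∂μ - 1) := by
        rw [integral_add hklint hsub, integral_sub hexpint (integrable_const _)]
        simp
    _ ≤ _ := by linarith

/-- The truncated integrand `u log v + 1 - v`, where `v` lies between `1` and `u`, is
nonnegative. -/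
lemma mul_log_add_one_sub_nonneg {u v : ℝ} (hv : 0 < v) (h : (1 ≤ v ∧ v ≤ u) ∨ (v ≤ 1 ∧ u ≤ v)) :
    0 ≤ u * Real.log v + 1 - v := by
  have hk := klFun_nonneg hv.le
  rw [klFun] at hk
  rcases h with ⟨h1, h2⟩ | ⟨h1, h2⟩
  · nlinarith [Real.log_nonneg h1]
  · nlinarith [Real.log_nonpos hv.le h1]

/-- The hard half of the Donsker–Varadhan duality: bounded measurable test functions recover the
relative entropy. The optimal `log (dκ/dμ)` is truncated, and Fatou's lemma applies because of
`mul_log_add_one_sub_nonneg`. -/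
lemma klDiv_le_of_forall_bounded {κ : Measure X} [IsProbabilityMeasure κ] (hκ : κ ≪ μ) {B : ℝ}
    (hB : ∀ (φ : X → ℝ) (C : ℝ), Measurable φ → (∀ x, |φ x| ≤ C) →
      ∫ x, φ x ∂κ + (1 - ∫ x, Real.exp (φ x) ∂μ) ≤ B) : klDiv κ μ ≤ ENNReal.ofReal B := by
  rw [klDiv_eq_lintegral_klFun_of_ac hκ]
  set u : X → ℝ := fun x => (κ.rnDeriv μ x).toReal with hu
  have hum : Measurable u := (Measure.measurable_rnDeriv κ μ).ennreal_toReal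
  set v : ℕ → X → ℝ := fun n x => max ((n : ℝ) + 1)⁻¹ (min (u x) (n + 1)) with hv
  have hvm : ∀ n, Measurable (v n) := fun n =>
    measurable_const.max (hum.min measurable_const)
  have hn0 : ∀ n : ℕ, (0 : ℝ) < ((n : ℝ) + 1)⁻¹ := fun n => by positivity
  have hn1 : ∀ n : ℕ, ((n : ℝ) + 1)⁻¹ ≤ 1 := fun n => inv_le_one_of_one_le₀ (by simp)
  have hn2 : ∀ n : ℕ, (1 : ℝ) ≤ (n : ℝ) + 1 := fun n => by simp
  have hv0 : ∀ n x, 0 < v n x := fun n x => (hn0 n).trans_le (le_max_left _ _)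
  have hvle : ∀ n x, v n x ≤ n + 1 := fun n x =>
    max_le ((hn1 n).trans (hn2 n)) (min_le_right _ _)
  have hlim : ∀ x, Tendsto (fun n => v n x) atTop (𝓝 (u x)) := fun x => by
    have h0 : Tendsto (fun n : ℕ => ((n : ℝ) + 1)⁻¹) atTop (𝓝 0) := by
      simpa [one_div] using tendsto_one_div_add_atTop_nhds_zero_nat (𝕜 := ℝ)
    have h1 : Tendsto (fun n : ℕ => min (u x) ((n : ℝ) + 1)) atTop (𝓝 (u x)) := by
      refine tendsto_const_nhds.congr' ?_
      filter_upwards [eventually_ge_atTop ⌈u x⌉₊] with n hn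
      rw [min_eq_left]
      linarith [Nat.le_of_ceil_le hn]
    have h2 := h0.max h1
    rwa [max_eq_right (show 0 ≤ u x from ENNReal.toReal_nonneg)] at h2
  have hbetween : ∀ n x, (1 ≤ v n x ∧ v n x ≤ u x) ∨ (v n x ≤ 1 ∧ u x ≤ v n x) := by
    intro n x
    rcases le_total 1 (u x) with h | h
    · left
      exact ⟨le_max_of_le_right (le_min h (hn2 n)),
        max_le ((hn1 n).trans h) (min_le_left _ _)⟩
    · right
      exact ⟨max_le (hn1 n) ((min_le_left _ _).trans h),
        le_max_of_le_right (le_min le_rfl (h.trans (hn2 n)))⟩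
  have hFlim : ∀ x, Tendsto (fun n => u x * Real.log (v n x) + 1 - v n x) atTop
      (𝓝 (klFun (u x))) := by
    intro x
    rw [klFun]
    refine Tendsto.sub (Tendsto.add_const _ ?_) (hlim x)
    rcases (show 0 ≤ u x from ENNReal.toReal_nonneg).eq_or_lt with h | h
    · rw [← h]
      simp
    · exact ((Real.continuousAt_log h.ne').tendsto.comp (hlim x)).const_mul _
  have hbound : ∀ n, ∫⁻ x, ENNReal.ofReal (u x * Real.log (v n x) + 1 - v n x) ∂μ
      ≤ ENNReal.ofReal B := by
    intro n
    have hlogb : ∀ x, |Real.log (v n x)| ≤ (n : ℝ) + 1 := by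
      intro x
      have hlog : Real.log ((n : ℝ) + 1) ≤ (n : ℝ) + 1 :=
        (Real.log_le_sub_one_of_pos (by positivity)).trans (by linarith)
      refine abs_le.2 ⟨?_, (Real.log_le_log (hv0 n x) (hvle n x)).trans hlog⟩
      have h1 : Real.log ((n : ℝ) + 1)⁻¹ ≤ Real.log (v n x) :=
        Real.log_le_log (hn0 n) (le_max_left _ _)
      rw [Real.log_inv] at h1
      linarith
    have hlogm : Measurable fun x => Real.log (v n x) := (hvm n).log
    have hlogi : Integrable (fun x => Real.log (v n x)) κ :=
      Integrable.of_bound hlogm.aestronglyMeasurable _ (ae_of_all _ hlogb)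
    have hulogi : Integrable (fun x => u x * Real.log (v n x)) μ :=
      (integrable_rnDeriv_smul_iff hκ).2 hlogi
    have hvi : Integrable (v n) μ := Integrable.of_bound (hvm n).aestronglyMeasurable ((n : ℝ) + 1)
      (ae_of_all _ fun x => by
        rw [Real.norm_eq_abs, abs_of_pos (hv0 n x)]
        exact hvle n x)
    have hFi : Integrable (fun x => u x * Real.log (v n x) + 1 - v n x) μ :=
      (hulogi.add (integrable_const 1)).sub hvi
    rw [← ofReal_integral_eq_lintegral_ofReal hFi
      (ae_of_all _ fun x => mul_log_add_one_sub_nonneg (hv0 n x) (hbetween n x))]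
    refine ENNReal.ofReal_le_ofReal ?_
    have h := hB _ _ hlogm hlogb
    rw [← integral_rnDeriv_smul hκ, integral_congr_ae (ae_of_all _ fun x => Real.exp_log (hv0 n x))]
      at h
    have hi1 : Integrable (fun x => u x * Real.log (v n x) + 1) μ :=
      hulogi.add (integrable_const 1)
    rw [integral_sub hi1 hvi, integral_add hulogi (integrable_const 1)]
    simp only [smul_eq_mul] at h
    simp only [integral_const, probReal_univ, smul_eq_mul, one_mul]
    linarith
  calc ∫⁻ x, ENNReal.ofReal (klFun (u x)) ∂μ
      = ∫⁻ x, liminf (fun n => ENNReal.ofReal (u x * Real.log (v n x) + 1 - v n x)) atTop ∂μ :=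
        lintegral_congr fun x => ((ENNReal.tendsto_ofReal (hFlim x)).liminf_eq).symm
    _ ≤ liminf (fun n => ∫⁻ x, ENNReal.ofReal (u x * Real.log (v n x) + 1 - v n x) ∂μ) atTop :=
        lintegral_liminf_le fun n =>
          (((hum.mul (hvm n).log).add_const 1).sub (hvm n)).ennreal_ofReal
    _ ≤ ENNReal.ofReal B := liminf_le_of_le (by isBoundedDefault) fun b hb => by
        obtain ⟨n, hn⟩ := hb.exists
        exact hn.trans (hbound n)

/-! ### The entropy term `ν(1/τ) H(ν̄ | μ)` -/

lemma isProbabilityMeasure_tilt (h0 : invTau τ ρ ≠ 0) (h1 : invTau τ ρ ≠ ∞) :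
    IsProbabilityMeasure (tilt τ ρ) := by
  refine ⟨?_⟩
  rw [tilt, Measure.smul_apply, withDensity_apply _ MeasurableSet.univ, Measure.restrict_univ,
    smul_eq_mul]
  exact ENNReal.inv_mul_cancel h0 h1

lemma tilt_absolutelyContinuous : tilt τ ρ ≪ ρ :=
  (withDensity_absolutelyContinuous _ _).smul_left _

lemma integral_tilt (hτ : Measurable τ) (h0 : ∀ᵐ x ∂ρ, τ x ≠ 0) (g : X → ℝ) :
    ∫ x, g x ∂(tilt τ ρ) = (invTau τ ρ).toReal⁻¹ * ∫ x, (τ x).toReal⁻¹ * g x ∂ρ := by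
  rw [tilt, integral_smul_measure, integral_withDensity_eq_integral_toReal_smul (f := fun x => (τ x)⁻¹) hτ.inv
    (h0.mono fun x hx => ENNReal.inv_lt_top.2 (pos_iff_ne_zero.2 hx)), ENNReal.toReal_inv,
    smul_eq_mul]
  simp only [ENNReal.toReal_inv, smul_eq_mul]

lemma integrable_tilt (hτ : Measurable τ) (h0 : ∀ᵐ x ∂ρ, τ x ≠ 0) (hinv : invTau τ ρ ≠ 0)
    {g : X → ℝ} (hg : Integrable (fun x => (τ x).toReal⁻¹ * g x) ρ) :
    Integrable g (tilt τ ρ) := by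
  refine Integrable.smul_measure ?_ (ENNReal.inv_ne_top.2 hinv)
  rw [integrable_withDensity_iff_integrable_smul' (f := fun x => (τ x)⁻¹) hτ.inv
    (h0.mono fun x hx => ENNReal.inv_lt_top.2 (pos_iff_ne_zero.2 hx))]
  simpa only [Pi.inv_apply, ENNReal.toReal_inv, smul_eq_mul] using hg

/-- If the test functions `ψ` with `μ(exp (τ ψ)) < 1` have bounded integrals, then `ρ(1/τ)` is
finite. The test function is `1/τ` where `τ` is small, and `-1/τ` elsewhere to compensate. -/
lemma invTau_lt_top_of_forall [IsFiniteMeasure ρ] (hτ : Measurable τ) (hρ : ρ ≪ μ)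
    (h0 : ∀ᵐ x ∂μ, τ x ≠ 0) (hfin : ∀ᵐ x ∂μ, τ x ≠ ∞) {N : ℝ}
    (hN : ∀ (ψ : X → ℝ) (C : ℝ), Measurable ψ → (∀ x, |ψ x| ≤ C) →
      ∫⁻ x, expWeight τ ψ x ∂μ < 1 → ∫ x, ψ x ∂ρ ≤ N) : invTau τ ρ < ∞ := by
  set T : X → ℝ := fun x => (τ x).toReal with hT
  have hTm : Measurable T := hτ.ennreal_toReal
  have hTpos : ∀ᵐ x ∂μ, 0 < T x := by
    filter_upwards [h0, hfin] with x hx hx' using ENNReal.toReal_pos hx hx'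
  set B : ℕ → Set X := fun n => {x | ((n : ℝ) + 1)⁻¹ ≤ T x} with hBdef
  have hBm : ∀ n, MeasurableSet (B n) := fun n => measurableSet_le measurable_const hTm
  have hBmono : Monotone B := fun m n hmn x hx => by
    refine le_trans ?_ (show ((m : ℝ) + 1)⁻¹ ≤ T x from hx)
    have : (m : ℝ) ≤ n := by exact_mod_cast hmn
    gcongr
  have hBU : ∀ x, 0 < T x → x ∈ ⋃ n, B n := fun x hx => by
    obtain ⟨n, hn⟩ := exists_nat_one_div_lt hx
    exact mem_iUnion.2 ⟨n, by simpa [hBdef, one_div] using hn.le⟩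
  have hB0 : ∀ n, ∀ x ∈ B n, 0 < T x := fun n x hx => lt_of_lt_of_le (by positivity) hx
  have hBinv : ∀ n, ∀ x ∈ B n, (T x)⁻¹ ≤ (n : ℝ) + 1 := fun n x hx =>
    inv_le_of_inv_le₀ (by positivity) hx
  -- `k` is such that `τ < 1 / (k + 1)` has small probability
  obtain ⟨k, hk⟩ : ∃ k, μ (B k)ᶜ < ENNReal.ofReal (1 / 6) := by
    have hlim : Tendsto (fun n => μ (B n)ᶜ) atTop (𝓝 (μ (⋂ n, (B n)ᶜ))) :=
      tendsto_measure_iInter_atTop (fun n => (hBm n).compl.nullMeasurableSet)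
        (fun m n hmn => compl_subset_compl.2 (hBmono hmn)) ⟨0, measure_ne_top _ _⟩
    have hz : μ (⋂ n, (B n)ᶜ) = 0 := by
      rw [← compl_iUnion]
      exact measure_mono_null (fun x hx h => hx (hBU x h)) hTpos
    rw [hz] at hlim
    exact (hlim.eventually (gt_mem_nhds (ENNReal.ofReal_pos.2 (by norm_num)))).exists
  have hint : ∀ n, IntegrableOn (fun x => (T x)⁻¹) (B n) ρ := fun n => by
    refine Measure.integrableOn_of_bounded (M := (n : ℝ) + 1) (measure_ne_top _ _)
      hTm.inv.aestronglyMeasurable ?_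
    filter_upwards [ae_restrict_mem (hBm n)] with x hx
    rw [Real.norm_eq_abs, abs_of_pos (inv_pos.2 (hB0 n x hx))]
    exact hBinv n x hx
  have hle : ∀ n, k ≤ n →
      ∫ x in B n, (T x)⁻¹ ∂ρ ≤ N + 2 * ∫ x in B k, (T x)⁻¹ ∂ρ := by
    intro n hkn
    have hi1 := (hint n).integrable_indicator (hBm n)
    have hi2 := (hint k).integrable_indicator (hBm k)
    have hm1 : Measurable ((B n).indicator fun x => (T x)⁻¹) := hTm.inv.indicator (hBm n)
    have hm2 : Measurable ((B k).indicator fun x => (T x)⁻¹) := hTm.inv.indicator (hBm k)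
    have hψ := hN (fun x => (B n).indicator (fun x => (T x)⁻¹) x
      - 2 * (B k).indicator (fun x => (T x)⁻¹) x) ((n : ℝ) + 1) (hm1.sub (hm2.const_mul 2)) ?_ ?_
    · rw [integral_sub hi1 (hi2.const_mul 2), integral_const_mul, integral_indicator (hBm n),
        integral_indicator (hBm k)] at hψ
      linarith
    · intro x
      by_cases hxn : x ∈ B n
      · have h1 := inv_pos.2 (hB0 n x hxn)
        have h2 := hBinv n x hxn
        by_cases hxk : x ∈ B k
        · simp only [indicator_of_mem hxn, indicator_of_mem hxk]
          rw [abs_le]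
          constructor <;> linarith
        · simp only [indicator_of_mem hxn, indicator_of_notMem hxk]
          rw [abs_le]
          constructor <;> linarith
      · have hxk : x ∉ B k := fun h => hxn (hBmono hkn h)
        simp only [indicator_of_notMem hxn, indicator_of_notMem hxk]
        simp only [mul_zero, sub_zero, abs_zero]
        positivity
    · calc _ ≤ ∫⁻ x, (ENNReal.ofReal (1 / 2) + (B k)ᶜ.indicator (fun _ => 3) x) ∂μ := by
            refine lintegral_mono fun x => ?_
            by_cases hxk : x ∈ B k
            · refine le_trans (ENNReal.ofReal_le_ofReal ?_) le_self_add
              simp only [indicator_of_mem (hBmono hkn hxk), indicator_of_mem hxk]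
              have h1 : T x * ((T x)⁻¹ - 2 * (T x)⁻¹) = -1 := by
                have := (hB0 k x hxk).ne'
                field_simp
                norm_num
              change Real.exp (T x * ((T x)⁻¹ - 2 * (T x)⁻¹)) ≤ 1 / 2
              rw [h1, Real.exp_neg, one_div]
              exact inv_anti₀ (by norm_num) (by linarith [Real.exp_one_gt_d9])
            · rw [indicator_of_mem (show x ∈ (B k)ᶜ from hxk)]
              refine le_trans ?_ le_add_self
              rw [← ENNReal.ofReal_ofNat]
              refine ENNReal.ofReal_le_ofReal ?_
              simp only [indicator_of_notMem hxk]
              have h1 : T x * ((B n).indicator (fun x => (T x)⁻¹) x - 2 * 0) ≤ 1 := by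
                by_cases hxn : x ∈ B n
                · rw [indicator_of_mem hxn, mul_zero, sub_zero, mul_inv_cancel₀ (hB0 n x hxn).ne']
                · rw [indicator_of_notMem hxn]
                  norm_num
              exact (Real.exp_le_exp.2 h1).trans (by linarith [Real.exp_one_lt_d9])
        _ = ENNReal.ofReal (1 / 2) + 3 * μ (B k)ᶜ := by
            rw [lintegral_add_left measurable_const, lintegral_const, measure_univ, mul_one,
              lintegral_indicator_const (hBm k).compl]
        _ < ENNReal.ofReal (1 / 2) + 3 * ENNReal.ofReal (1 / 6) :=
            ENNReal.add_lt_add_left ENNReal.ofReal_ne_top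
              (ENNReal.mul_lt_mul_right (by norm_num) (by norm_num) hk)
        _ = 1 := by
            rw [← ENNReal.ofReal_ofNat, ← ENNReal.ofReal_mul (by norm_num),
              ← ENNReal.ofReal_add (by norm_num) (by norm_num)]
            norm_num
  set σ : Measure X := ρ.withDensity fun x => (τ x)⁻¹ with hσ
  have hinv : invTau τ ρ = σ univ := by
    rw [hσ, withDensity_apply _ MeasurableSet.univ, Measure.restrict_univ, invTau]
  have hσμ : σ ≪ μ := (withDensity_absolutelyContinuous _ _).trans hρ
  have hσB : ∀ n, σ (B n) = ENNReal.ofReal (∫ x in B n, (T x)⁻¹ ∂ρ) := by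
    intro n
    rw [hσ, withDensity_apply _ (hBm n), ofReal_integral_eq_lintegral_ofReal (hint n)
      (ae_of_all _ fun x => inv_nonneg.2 ENNReal.toReal_nonneg)]
    refine setLIntegral_congr_fun_ae (hBm n) ?_
    filter_upwards [hρ.ae_le h0, hρ.ae_le hfin] with x hx hx' _
    rw [ENNReal.ofReal_inv_of_pos (ENNReal.toReal_pos hx hx'), ENNReal.ofReal_toReal hx']
  have hcover : σ univ = σ (⋃ n, B n) := by
    refine measure_congr (eventuallyEq_univ.2 ?_).symm
    filter_upwards [hσμ.ae_le hTpos] with x hx using hBU x hx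
  rw [hinv, hcover, hBmono.measure_iUnion]
  refine lt_of_le_of_lt (iSup_le fun n => (measure_mono (hBmono (le_max_left n k))).trans ?_)
    (ENNReal.ofReal_lt_top (r := N + 2 * ∫ x in B k, (T x)⁻¹ ∂ρ))
  rw [hσB]
  exact ENNReal.ofReal_le_ofReal (hle _ (le_max_right _ _))

lemma integrable_inv_toReal [IsFiniteMeasure ρ] (hτ : Measurable τ) (hinv : invTau τ ρ < ∞) :
    Integrable (fun x => (τ x).toReal⁻¹) ρ := by
  simpa only [Pi.inv_apply, ENNReal.toReal_inv] using
    integrable_toReal_of_lintegral_ne_top hτ.inv.aemeasurable hinv.ne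

lemma toReal_invTau (hτ : Measurable τ) (h0 : ∀ᵐ x ∂ρ, τ x ≠ 0) :
    (invTau τ ρ).toReal = ∫ x, (τ x).toReal⁻¹ ∂ρ := by
  have h := integral_toReal (μ := ρ) (f := fun x => (τ x)⁻¹) hτ.inv.aemeasurable
    (h0.mono fun x hx => ENNReal.inv_lt_top.2 (pos_iff_ne_zero.2 hx))
  simp only [ENNReal.toReal_inv] at h
  exact h.symm

/-- Test functions `φ / τ` with `φ` bounded: they are bounded once cut off where `τ` is small. -/
lemma integral_inv_mul_le_of_forall [IsFiniteMeasure ρ] (hτ : Measurable τ) (hρ : ρ ≪ μ)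
    (h0 : ∀ᵐ x ∂μ, τ x ≠ 0) (hfin : ∀ᵐ x ∂μ, τ x ≠ ∞) (hinv : invTau τ ρ < ∞) {N : ℝ}
    (hN : ∀ (ψ : X → ℝ) (C : ℝ), Measurable ψ → (∀ x, |ψ x| ≤ C) →
      ∫⁻ x, expWeight τ ψ x ∂μ < 1 → ∫ x, ψ x ∂ρ ≤ N)
    {φ : X → ℝ} (hφ : Measurable φ) {C : ℝ} (hC : ∀ x, |φ x| ≤ C)
    (hlt : ∫⁻ x, ENNReal.ofReal (Real.exp (φ x)) ∂μ < 1) :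
    ∫ x, (τ x).toReal⁻¹ * φ x ∂ρ ≤ N := by
  set T : X → ℝ := fun x => (τ x).toReal with hT
  have hTm : Measurable T := hτ.ennreal_toReal
  have hTpos : ∀ᵐ x ∂μ, 0 < T x := by
    filter_upwards [h0, hfin] with x hx hx' using ENNReal.toReal_pos hx hx'
  have hT0 : ∀ x, 0 ≤ T x := fun x => ENNReal.toReal_nonneg
  set B : ℕ → Set X := fun n => {x | ((n : ℝ) + 1)⁻¹ ≤ T x} with hBdef
  have hBm : ∀ n, MeasurableSet (B n) := fun n => measurableSet_le measurable_const hTm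
  have hev : ∀ x, 0 < T x → ∀ᶠ n in atTop, x ∈ B n := fun x hx => by
    have h := tendsto_one_div_add_atTop_nhds_zero_nat (𝕜 := ℝ)
    filter_upwards [h.eventually (gt_mem_nhds hx)] with n hn
    simpa [hBdef, one_div] using le_of_lt hn
  set ψ : ℕ → X → ℝ := fun n => (B n).indicator fun x => (T x)⁻¹ * φ x with hψ
  have hψm : ∀ n, Measurable (ψ n) := fun n => (hTm.inv.mul hφ).indicator (hBm n)
  have hψb : ∀ n x, |ψ n x| ≤ ((n : ℝ) + 1) * |C| := by
    intro n x
    by_cases hx : x ∈ B n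
    · rw [hψ]
      simp only [indicator_of_mem hx]
      rw [abs_mul, abs_of_nonneg (inv_nonneg.2 (hT0 x))]
      have h1 : (T x)⁻¹ ≤ (n : ℝ) + 1 := inv_le_of_inv_le₀ (by positivity) hx
      have h2 := (hC x).trans (le_abs_self C)
      gcongr
    · rw [hψ]
      simp only [indicator_of_notMem hx, abs_zero]
      positivity
  have hlim1 : Tendsto (fun n => ∫⁻ x, expWeight τ (ψ n) x ∂μ) atTop
      (𝓝 (∫⁻ x, ENNReal.ofReal (Real.exp (φ x)) ∂μ)) := by
    refine tendsto_lintegral_of_dominated_convergence (fun _ => ENNReal.ofReal (Real.exp |C|))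
      (fun n => measurable_expWeight hτ (hψm n)) (fun n => ae_of_all _ fun x => ?_) ?_ ?_
    · refine ENNReal.ofReal_le_ofReal (Real.exp_le_exp.2 ?_)
      change T x * ψ n x ≤ |C|
      by_cases hx : x ∈ B n
      · have hx0 : 0 < T x := lt_of_lt_of_le (by positivity) hx
        rw [hψ]
        simp only [indicator_of_mem hx]
        rw [mul_inv_cancel_left₀ hx0.ne']
        exact (le_abs_self _).trans ((hC x).trans (le_abs_self _))
      · rw [hψ]
        simp only [indicator_of_notMem hx, mul_zero]
        exact abs_nonneg _
    · rw [lintegral_const, measure_univ, mul_one]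
      exact ENNReal.ofReal_ne_top
    · filter_upwards [hTpos] with x hx
      refine tendsto_const_nhds.congr' ?_
      filter_upwards [hev x hx] with n hn
      rw [expWeight, hψ]
      simp only [indicator_of_mem hn]
      rw [mul_inv_cancel_left₀ hx.ne']
  have hlim2 : Tendsto (fun n => ∫ x, ψ n x ∂ρ) atTop (𝓝 (∫ x, (T x)⁻¹ * φ x ∂ρ)) := by
    refine tendsto_integral_of_dominated_convergence (fun x => (T x)⁻¹ * |C|)
      (fun n => (hψm n).aestronglyMeasurable) ((integrable_inv_toReal hτ hinv).mul_const _)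
      (fun n => ae_of_all _ fun x => ?_) ?_
    · refine (norm_indicator_le_norm_self _ _).trans ?_
      rw [Real.norm_eq_abs, abs_mul, abs_of_nonneg (inv_nonneg.2 (hT0 x))]
      exact mul_le_mul_of_nonneg_left ((hC x).trans (le_abs_self C)) (inv_nonneg.2 (hT0 x))
    · filter_upwards [hρ.ae_le hTpos] with x hx
      refine tendsto_const_nhds.congr' ?_
      filter_upwards [hev x hx] with n hn
      rw [hψ]
      simp only [indicator_of_mem hn]
  refine le_of_tendsto hlim2 ?_
  filter_upwards [hlim1.eventually (gt_mem_nhds hlt)] with n hn using hN _ _ (hψm n) (hψb n) hn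

/-- Normalizing a bounded `φ` by a constant removes the constraint on its exponential moment. -/
lemma integral_inv_mul_add_le_of_forall [IsFiniteMeasure ρ] (hτ : Measurable τ) (hρ : ρ ≪ μ)
    (h0 : ∀ᵐ x ∂μ, τ x ≠ 0) (hfin : ∀ᵐ x ∂μ, τ x ≠ ∞) (hinv : invTau τ ρ < ∞) {N : ℝ}
    (hN : ∀ (ψ : X → ℝ) (C : ℝ), Measurable ψ → (∀ x, |ψ x| ≤ C) →
      ∫⁻ x, expWeight τ ψ x ∂μ < 1 → ∫ x, ψ x ∂ρ ≤ N)
    {φ : X → ℝ} (hφ : Measurable φ) {C : ℝ} (hC : ∀ x, |φ x| ≤ C) :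
    ∫ x, (τ x).toReal⁻¹ * φ x ∂ρ +
      (invTau τ ρ).toReal * (1 - ∫ x, Real.exp (φ x) ∂μ) ≤ N := by
  set l : ℝ := (invTau τ ρ).toReal with hl
  have hl0 : 0 ≤ l := ENNReal.toReal_nonneg
  have hexpi : Integrable (fun x => Real.exp (φ x)) μ :=
    Integrable.of_bound hφ.exp.aestronglyMeasurable (Real.exp C) (ae_of_all _ fun x => by
      rw [Real.norm_eq_abs, Real.abs_exp]
      exact Real.exp_le_exp.2 ((le_abs_self _).trans (hC x)))
  set a : ℝ := ∫ x, Real.exp (φ x) ∂μ with ha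
  have ha0 : 0 < a := integral_exp_pos hexpi
  have hmain : ∀ δ : ℝ, 0 < δ → ∫ x, (τ x).toReal⁻¹ * φ x ∂ρ - l * (Real.log a + δ) ≤ N := by
    intro δ hδ
    have h := integral_inv_mul_le_of_forall hτ hρ h0 hfin hinv hN
      (φ := fun x => φ x - (Real.log a + δ)) (hφ.sub_const _) (C := C + |Real.log a + δ|)
      (fun x => (abs_sub _ _).trans (by gcongr; exact hC x)) (by
        have he : ∀ x, Real.exp (φ x - (Real.log a + δ)) =
            Real.exp (φ x) * (a * Real.exp δ)⁻¹ := fun x => by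
          rw [Real.exp_sub, Real.exp_add, Real.exp_log ha0, div_eq_mul_inv]
        simp only [he]
        rw [← ofReal_integral_eq_lintegral_ofReal (hexpi.mul_const _)
          (ae_of_all _ fun x => by positivity), integral_mul_const, ENNReal.ofReal_lt_one, ← ha,
          mul_inv_lt_iff₀ (by positivity), one_mul]
        exact lt_mul_of_one_lt_right ha0 (Real.one_lt_exp_iff.2 hδ))
    have hi1 : Integrable (fun x => (τ x).toReal⁻¹ * φ x) ρ := by
      refine (integrable_inv_toReal hτ hinv).mul_bdd (c := C) hφ.aestronglyMeasurable
        (ae_of_all _ hC)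
    have hi2 : Integrable (fun x => (τ x).toReal⁻¹ * (Real.log a + δ)) ρ :=
      (integrable_inv_toReal hτ hinv).mul_const _
    simp only [mul_sub] at h
    rwa [integral_sub hi1 hi2, integral_mul_const, ← toReal_invTau hτ (hρ.ae_le h0)] at h
  have hlog : ∫ x, (τ x).toReal⁻¹ * φ x ∂ρ - l * Real.log a ≤ N := by
    refine le_of_forall_pos_le_add fun ε hε => ?_
    have h := hmain (ε / (l + 1)) (by positivity)
    have h2 : l * (ε / (l + 1)) ≤ ε := by
      rw [← mul_div_assoc, div_le_iff₀ (by positivity)]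
      nlinarith
    linarith
  have h3 := mul_le_mul_of_nonneg_left (Real.log_le_sub_one_of_pos ha0) hl0
  linarith

/-- The entropy term is at most the supremum of `∫ ψ dρ` over bounded `ψ` with
`μ(exp (τ ψ)) < 1`. -/
theorem invTau_mul_klDiv_le_of_forall [IsFiniteMeasure ρ] (hτ : Measurable τ) (hρ : ρ ≪ μ)
    (h0 : ∀ᵐ x ∂μ, τ x ≠ 0) (hfin : ∀ᵐ x ∂μ, τ x ≠ ∞) {N : ℝ}
    (hN : ∀ (ψ : X → ℝ) (C : ℝ), Measurable ψ → (∀ x, |ψ x| ≤ C) →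
      ∫⁻ x, expWeight τ ψ x ∂μ < 1 → ∫ x, ψ x ∂ρ ≤ N) :
    invTau τ ρ < ∞ ∧ 0 ≤ N ∧ invTau τ ρ * klDiv (tilt τ ρ) μ ≤ ENNReal.ofReal N := by
  have hinv := invTau_lt_top_of_forall hτ hρ h0 hfin hN
  have hN0 : 0 ≤ N := by
    simpa using integral_inv_mul_add_le_of_forall hτ hρ h0 hfin hinv hN (φ := fun _ => 0)
      measurable_const (C := 0) (by simp)
  refine ⟨hinv, hN0, ?_⟩
  by_cases hz : invTau τ ρ = 0
  · simp [hz]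
  have := isProbabilityMeasure_tilt hz hinv.ne
  have hl : 0 < (invTau τ ρ).toReal := ENNReal.toReal_pos hz hinv.ne
  have hkl := klDiv_le_of_forall_bounded (tilt_absolutelyContinuous.trans hρ)
    (B := N / (invTau τ ρ).toReal) fun φ C hφ hC => by
      have h := integral_inv_mul_add_le_of_forall hτ hρ h0 hfin hinv hN hφ hC
      rw [integral_tilt hτ (hρ.ae_le h0), le_div_iff₀ hl, add_mul, mul_comm _⁻¹, mul_assoc,
        inv_mul_cancel₀ hl.ne']
      linarith
  calc invTau τ ρ * klDiv (tilt τ ρ) μ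
      ≤ ENNReal.ofReal (invTau τ ρ).toReal * ENNReal.ofReal (N / (invTau τ ρ).toReal) := by
        rw [ENNReal.ofReal_toReal hinv.ne]
        gcongr
    _ = ENNReal.ofReal N := by
        rw [← ENNReal.ofReal_mul hl.le, mul_div_cancel₀ _ hl.ne']

/-- The entropy term is at least `∫ ψ dρ` for bounded `ψ` with `μ(exp (τ ψ)) ≤ 1`. -/
theorem ofReal_integral_le_invTau_mul_klDiv [IsFiniteMeasure ρ] (hτ : Measurable τ) (hρ : ρ ≪ μ)
    (h0 : ∀ᵐ x ∂μ, τ x ≠ 0) (hfin : ∀ᵐ x ∂μ, τ x ≠ ∞) (hinv : invTau τ ρ < ∞)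
    {ψ : X → ℝ} (hψ : Measurable ψ) {C : ℝ} (hC : ∀ x, |ψ x| ≤ C)
    (hle : ∫⁻ x, expWeight τ ψ x ∂μ ≤ 1) :
    ENNReal.ofReal (∫ x, ψ x ∂ρ) ≤ invTau τ ρ * klDiv (tilt τ ρ) μ := by
  by_cases hz : invTau τ ρ = 0
  · -- `1 / τ` is positive almost everywhere, so its integral vanishes only if `ρ = 0`
    have h1 : ∀ᵐ x ∂ρ, (τ x)⁻¹ = 0 := (lintegral_eq_zero_iff hτ.inv).1 hz
    have hρ0 : ρ = 0 := by
      rw [← Measure.measure_univ_eq_zero, ← compl_empty]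
      change ∀ᵐ x ∂ρ, x ∈ (∅ : Set X)
      filter_upwards [h1, hρ.ae_le hfin] with x hx hx' using hx' (ENNReal.inv_eq_zero.1 hx)
    simp [hρ0]
  by_cases hkl : klDiv (tilt τ ρ) μ = ∞
  · rw [hkl, ENNReal.mul_top hz]
    exact le_top
  have := isProbabilityMeasure_tilt hz hinv.ne
  have hl : 0 < (invTau τ ρ).toReal := ENNReal.toReal_pos hz hinv.ne
  have hcancel : (fun x => (τ x).toReal⁻¹ * ((τ x).toReal * ψ x)) =ᵐ[ρ] ψ := by
    filter_upwards [hρ.ae_le h0, hρ.ae_le hfin] with x hx hx'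
    rw [inv_mul_cancel_left₀ (ENNReal.toReal_pos hx hx').ne']
  have hψi : Integrable ψ ρ := Integrable.of_bound hψ.aestronglyMeasurable C (ae_of_all _ hC)
  have h := integral_le_toReal_klDiv (tilt_absolutelyContinuous.trans hρ) hkl
    (φ := fun x => (τ x).toReal * ψ x) (hτ.ennreal_toReal.mul hψ) (integrable_tilt hτ (hρ.ae_le h0) hz (hψi.congr hcancel.symm)) hle
  rw [integral_tilt hτ (hρ.ae_le h0), integral_congr_ae hcancel, inv_mul_le_iff₀ hl,
    ← ENNReal.toReal_mul] at h
  exact ENNReal.ofReal_le_of_le_toReal h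

end Entropy

/-! ### The dual formula for `rateI'` -/

section Duality

open Filter Topology InformationTheory

section MeasurableSpace

variable {X : Type*} [MeasurableSpace X] {μ : Measure X}

instance isFiniteMeasure_acPart (ν : Measure X) [IsFiniteMeasure ν] :
    IsFiniteMeasure (acPart ν μ) := by
  unfold acPart
  infer_instance

lemma acPart_absolutelyContinuous (ν : Measure X) : acPart ν μ ≪ μ :=
  withDensity_absolutelyContinuous _ _

lemma ofReal_integral_le_lintegral {α : Type*} [MeasurableSpace α] {m : Measure α} {f : α → ℝ}
    (hf : Integrable f m) : ENNReal.ofReal (∫ x, f x ∂m) ≤ ∫⁻ x, ENNReal.ofReal (f x) ∂m := by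
  calc ENNReal.ofReal (∫ x, f x ∂m) ≤ ENNReal.ofReal (∫ x, max (f x) 0 ∂m) :=
        ENNReal.ofReal_le_ofReal (integral_mono hf hf.pos_part fun x => le_max_left _ _)
    _ = ∫⁻ x, ENNReal.ofReal (max (f x) 0) ∂m :=
        ofReal_integral_eq_lintegral_ofReal hf.pos_part (ae_of_all _ fun x => le_max_right _ _)
    _ = ∫⁻ x, ENNReal.ofReal (f x) ∂m := by simp

lemma SubProb.real_univ_le_one (ν : SubProb X) : ν.1.real univ ≤ 1 :=
  ENNReal.toReal_le_of_le_ofReal zero_le_one (by simpa using ν.2)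

lemma SubProb.ofReal_one_sub_real_univ (ν : SubProb X) :
    ENNReal.ofReal (1 - ν.1.real univ) = 1 - ν.1 univ := by
  rw [ENNReal.ofReal_sub _ measureReal_nonneg, ENNReal.ofReal_one, ofReal_measureReal]

lemma SubProb.mix_zero_left (b : ℝ≥0) (hb : 0 + b = 1) (ν₁ ν₂ : SubProb X) :
    SubProb.mix 0 b hb ν₁ ν₂ = ν₂ := by
  have hb' : b = 1 := by simpa using hb
  subst hb'
  exact Subtype.ext (by simp [SubProb.mix])

lemma SubProb.mix_zero_right (a : ℝ≥0) (ha : a + 0 = 1) (ν₁ ν₂ : SubProb X) :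
    SubProb.mix a 0 ha ν₁ ν₂ = ν₁ := by
  have ha' : a = 1 := by simpa using ha
  subst ha'
  exact Subtype.ext (by simp [SubProb.mix])

end MeasurableSpace

variable {X : Type*} [MetricSpace X] [MeasurableSpace X] {μ : Measure X} {τ : X → ℝ≥0∞}

lemma isClosed_setOf_dualBound (M : ℝ) : IsClosed {ν : SubProb X | DualBound μ τ ν.1 M} := by
  simp only [DualBound, ofPred_forall]
  exact isClosed_iInter fun f => isClosed_iInter fun c => isClosed_iInter fun _ =>
    isClosed_le ((SubProb.continuous_integral f).add continuous_const) continuous_const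

variable [BorelSpace X]

/-- A continuous function with finite exponential moment is nowhere above `ξ`. -/
lemma ofReal_le_xi (hfin : ∀ᵐ x ∂μ, τ x ≠ ∞) {ψ : X → ℝ} (hψ : Continuous ψ)
    (hle : ∫⁻ x, expWeight τ ψ x ∂μ ≤ 1) (x : X) : ENNReal.ofReal (ψ x) ≤ xi μ τ x := by
  refine ENNReal.le_of_forall_nnreal_lt fun c hc => ?_
  have hcψ : (c : ℝ) < ψ x := by
    by_contra! h
    exact hc.not_ge (by simpa using ENNReal.ofReal_le_ofReal h)
  obtain ⟨δ, hδ, hball⟩ := Metric.isOpen_iff.1 (isOpen_lt continuous_const hψ) x hcψ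
  refine (le_expRate hfin ?_).trans
    (le_iSup₂ (f := fun (δ : ℝ) (_ : 0 < δ) => expRate μ τ (Metric.ball x δ)) δ hδ)
  calc _ ≤ ∫⁻ y in Metric.ball x δ, expWeight τ ψ y ∂μ :=
        setLIntegral_mono' Metric.isOpen_ball.measurableSet fun y hy =>
          expWeight_mono (le_of_lt (hball hy))
    _ ≤ ∫⁻ y, expWeight τ ψ y ∂μ := setLIntegral_le_lintegral _ _
    _ < ∞ := hle.trans_lt ENNReal.one_lt_top

lemma ofReal_le_xiInfty (hfin : ∀ᵐ x ∂μ, τ x ≠ ∞) (f : C_c(X, ℝ)) {c : ℝ}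
    (hle : ∫⁻ x, expWeight τ (fun x => f x + c) x ∂μ ≤ 1) :
    ENNReal.ofReal c ≤ xiInfty μ τ := by
  rcases le_total c 0 with hc | hc
  · simp [ENNReal.ofReal_of_nonpos hc]
  lift c to ℝ≥0 using hc
  rw [ENNReal.ofReal_coe_nnreal]
  have hK : IsCompact (tsupport f) := f.hasCompactSupport
  refine (le_expRate (A := (tsupport f)ᶜ) hfin ?_).trans
    (le_iSup₂ (f := fun (K : Set X) (_ : IsCompact K) => expRate μ τ Kᶜ) _ hK)
  calc _ = ∫⁻ x in (tsupport f)ᶜ, expWeight τ (fun x => f x + c) x ∂μ :=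
        setLIntegral_congr_fun hK.measurableSet.compl fun x hx => expWeight_congr (by
          rw [image_eq_zero_of_notMem_tsupport hx, zero_add])
    _ ≤ ∫⁻ x, expWeight τ (fun x => f x + c) x ∂μ := setLIntegral_le_lintegral _ _
    _ < ∞ := hle.trans_lt ENNReal.one_lt_top

lemma DualBound.mix {ν₁ ν₂ : SubProb X} {M₁ M₂ : ℝ} (h₁ : DualBound μ τ ν₁.1 M₁)
    (h₂ : DualBound μ τ ν₂.1 M₂) (a b : ℝ≥0) (hab : a + b = 1) :
    DualBound μ τ (SubProb.mix a b hab ν₁ ν₂).1 (a * M₁ + b * M₂) := by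
  intro f c hle
  have e1 := mul_le_mul_of_nonneg_left (h₁ f c hle) a.2
  have e2 := mul_le_mul_of_nonneg_left (h₂ f c hle) b.2
  have hint : ∫ x, f x ∂(SubProb.mix a b hab ν₁ ν₂).1 =
      a * ∫ x, f x ∂ν₁.1 + b * ∫ x, f x ∂ν₂.1 := by
    change ∫ x, f x ∂(a • ν₁.1 + b • ν₂.1) = _
    rw [integral_add_measure ((integrable_compactlySupported f _).smul_measure_nnreal)
      ((integrable_compactlySupported f _).smul_measure_nnreal), integral_smul_nnreal_measure,
      integral_smul_nnreal_measure]
    rfl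
  have hab' : (a : ℝ) + b = 1 := by exact_mod_cast hab
  rw [hint]
  calc a * ∫ x, f x ∂ν₁.1 + b * ∫ x, f x ∂ν₂.1 + c
      = a * (∫ x, f x ∂ν₁.1 + c) + b * (∫ x, f x ∂ν₂.1 + c) := by linear_combination (-c) * hab'
    _ ≤ _ := add_le_add e1 e2

variable [IsProbabilityMeasure μ]

/-- Each of the three terms of `rateI'` bounds its part of `ν(f) + c`. -/
theorem dualBound_of_rateI'_le (hτ : Measurable τ) (h0 : ∀ᵐ x ∂μ, τ x ≠ 0)
    (hfin : ∀ᵐ x ∂μ, τ x ≠ ∞) {ν : SubProb X} {M : ℝ≥0} (hM : rateI' μ τ ν ≤ M) :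
    DualBound μ τ ν.1 M := by
  intro f c hle
  rw [rateI'] at hM
  split_ifs at hM with hinv
  swap
  · exact absurd hM (by simp)
  have hψc : Continuous fun x => f x + c := f.continuous.add continuous_const
  have hψm : Measurable fun x => f x + c := hψc.measurable
  obtain ⟨C, hC⟩ := f.hasCompactSupport.exists_bound_of_continuous f.continuous
  have hψb : ∀ x, |f x + c| ≤ C + |c| := fun x =>
    (abs_add_le _ _).trans (by gcongr; exact hC x)
  have hψi : ∀ m : Measure X, [IsFiniteMeasure m] → Integrable (fun x => f x + c) m := fun m _ =>
    Integrable.of_bound hψm.aestronglyMeasurable _ (ae_of_all _ hψb)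
  have e1 : ENNReal.ofReal (∫ x, (f x + c) ∂(acPart ν.1 μ)) ≤
      invTau τ (acPart ν.1 μ) * klDiv (tilt τ (acPart ν.1 μ)) μ :=
    ofReal_integral_le_invTau_mul_klDiv hτ (acPart_absolutelyContinuous _) h0 hfin hinv hψm hψb hle
  have e2 : ENNReal.ofReal (∫ x, (f x + c) ∂(ν.1.singularPart μ)) ≤
      ∫⁻ x, xi μ τ x ∂(ν.1.singularPart μ) :=
    (ofReal_integral_le_lintegral (hψi _)).trans (lintegral_mono (ofReal_le_xi hfin hψc hle))
  have e3 : ENNReal.ofReal ((1 - ν.1.real univ) * c) ≤ (1 - ν.1 univ) * xiInfty μ τ := by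
    rw [ENNReal.ofReal_mul (sub_nonneg.2 ν.real_univ_le_one), ν.ofReal_one_sub_real_univ]
    gcongr
    exact ofReal_le_xiInfty hfin f hle
  have hdec : ∫ x, (f x + c) ∂ν.1 =
      ∫ x, (f x + c) ∂(ν.1.singularPart μ) + ∫ x, (f x + c) ∂(acPart ν.1 μ) := by
    rw [← integral_add_measure (hψi _) (hψi _)]
    congr 1
    exact ν.1.haveLebesgueDecomposition_add μ
  have hconst : ∫ x, (f x + c) ∂ν.1 = ∫ x, f x ∂ν.1 + ν.1.real univ * c := by
    rw [integral_add (integrable_compactlySupported f _) (integrable_const _), integral_const,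
      smul_eq_mul]
  have htotal : ENNReal.ofReal (∫ x, f x ∂ν.1 + c) ≤ M := by
    calc ENNReal.ofReal (∫ x, f x ∂ν.1 + c)
        = ENNReal.ofReal (∫ x, (f x + c) ∂(acPart ν.1 μ) +
            ∫ x, (f x + c) ∂(ν.1.singularPart μ) + (1 - ν.1.real univ) * c) := by
          congr 1
          linarith
      _ ≤ _ := ENNReal.ofReal_add_le.trans (add_le_add ENNReal.ofReal_add_le le_rfl)
      _ ≤ _ := add_le_add (add_le_add e1 e2) e3
      _ ≤ M := hM
  rw [← ENNReal.ofReal_coe_nnreal] at htotal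
  exact (ENNReal.ofReal_le_ofReal_iff M.2).1 htotal

/-- The test functions in the dual bound are rich enough to recover all three terms of `rateI'`. -/
theorem rateI'_le_of_dualBound [PolishSpace X] [LocallyCompactSpace X] (hτ : Measurable τ)
    (h0 : ∀ᵐ x ∂μ, τ x ≠ 0) (hfin : ∀ᵐ x ∂μ, τ x ≠ ∞) (hξ : ∀ᵐ x ∂μ, xi μ τ x = ∞)
    {ν : SubProb X} {M : ℝ≥0} (hJ : DualBound μ τ ν.1 M) : rateI' μ τ ν ≤ M := by
  have hν1 := ν.real_univ_le_one
  have key : ∀ (θ : X → ℝ) (D : ℝ), Measurable θ → (∀ x, 0 ≤ θ x) → (∀ x, |θ x| ≤ D) →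
      (∀ x, θ x ≠ 0 → ENNReal.ofReal (θ x) < xi μ τ x) → ∀ c : ℝ≥0,
      (c = 0 ∨ (c : ℝ≥0∞) < xiInfty μ τ) →
      invTau τ (acPart ν.1 μ) < ∞ ∧
      invTau τ (acPart ν.1 μ) * klDiv (tilt τ (acPart ν.1 μ)) μ +
        ∫⁻ x, ENNReal.ofReal (θ x) ∂(ν.1.singularPart μ) + (1 - ν.1 univ) * c ≤ M := by
    intro θ D hθ hθ0 hD hθξ c hc
    obtain ⟨L, hL, hcL⟩ := exists_compact_lintegral_expWeight_lt_top hfin hc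
    obtain ⟨h1, h2, h3⟩ := invTau_mul_klDiv_le_of_forall hτ
      (acPart_absolutelyContinuous (μ := μ) ν.1) h0 hfin
      (N := M - ∫ x, θ x ∂(ν.1.singularPart μ) - c * (1 - ν.1.real univ))
      fun ψ C hψ hC hlt => by
        have := hJ.integral_acPart_add_le hτ hfin hξ hψ hC hlt hθ hD hθξ hL hcL
        linarith
    refine ⟨h1, ?_⟩
    have hc0 : 0 ≤ (1 - ν.1.real univ) * (c : ℝ) := mul_nonneg (sub_nonneg.2 hν1) c.2
    have hθI : 0 ≤ ∫ x, θ x ∂(ν.1.singularPart μ) := integral_nonneg hθ0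
    rw [← ofReal_integral_eq_lintegral_ofReal (Integrable.of_bound hθ.aestronglyMeasurable D
      (ae_of_all _ hD)) (ae_of_all _ hθ0), ← ν.ofReal_one_sub_real_univ, ← ENNReal.ofReal_coe_nnreal (p := c),
      ← ENNReal.ofReal_mul (sub_nonneg.2 hν1)]
    calc _ ≤ ENNReal.ofReal (M - ∫ x, θ x ∂(ν.1.singularPart μ) - c * (1 - ν.1.real univ)) +
          ENNReal.ofReal (∫ x, θ x ∂(ν.1.singularPart μ)) +
          ENNReal.ofReal ((1 - ν.1.real univ) * c) := by gcongr
      _ = ENNReal.ofReal M := by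
          rw [← ENNReal.ofReal_add h2 hθI, ← ENNReal.ofReal_add (add_nonneg h2 hθI) hc0]
          congr 1
          ring
      _ = M := ENNReal.ofReal_coe_nnreal
  have hinv : invTau τ (acPart ν.1 μ) < ∞ :=
    (key (fun _ => 0) 0 measurable_const (by simp) (by simp) (by simp) 0 (Or.inl rfl)).1
  rw [rateI', if_pos hinv]
  -- `ξ` and `ξ^∞` are approximated strictly from below by `t n * min ξ n`, with `t n ↑ 1`
  obtain ⟨t, htmono, ht, htlim⟩ := exists_seq_strictMono_tendsto' (zero_lt_one (α := ℝ≥0∞))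
  have happ_lim : ∀ y : ℝ≥0∞, Tendsto (fun n : ℕ => t n * min y n) atTop (𝓝 y) := fun y => by
    have h1 : Tendsto (fun n : ℕ => min y (n : ℝ≥0∞)) atTop (𝓝 (min y ∞)) :=
      tendsto_const_nhds.min ENNReal.tendsto_nat_nhds_top
    have h2 := ENNReal.Tendsto.mul htlim (Or.inl one_ne_zero) h1 (Or.inr ENNReal.one_ne_top)
    simpa using h2
  have happ_le : ∀ (y : ℝ≥0∞) (n : ℕ), t n * min y n ≤ n := fun y n =>
    (mul_le_of_le_one_left' (ht n).2.le).trans (min_le_right _ _)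
  have happ_top : ∀ (y : ℝ≥0∞) (n : ℕ), t n * min y n ≠ ∞ := fun y n =>
    ((happ_le y n).trans_lt (ENNReal.natCast_lt_top n)).ne
  have happ_lt : ∀ (y : ℝ≥0∞) (n : ℕ), t n * min y n ≠ 0 → t n * min y n < y := fun y n h => by
    have h0 : min y (n : ℝ≥0∞) ≠ 0 := right_ne_zero_of_mul h
    have h1 : min y (n : ℝ≥0∞) ≠ ∞ :=
      ((min_le_right _ _).trans_lt (ENNReal.natCast_lt_top n)).ne
    calc t n * min y n < 1 * min y n := ENNReal.mul_lt_mul_left h0 h1 (ht n).2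
      _ ≤ y := by rw [one_mul]; exact min_le_left _ _
  have hξm : Measurable (xi μ τ) := (lowerSemicontinuous_xi μ τ).measurable
  have happ_meas : ∀ n : ℕ, Measurable fun x => t n * min (xi μ τ x) n := fun n =>
    (hξm.min measurable_const).const_mul _
  have hlim1 : Tendsto (fun n : ℕ => ∫⁻ x, t n * min (xi μ τ x) n ∂(ν.1.singularPart μ)) atTop
      (𝓝 (∫⁻ x, xi μ τ x ∂(ν.1.singularPart μ))) := by
    refine lintegral_tendsto_of_tendsto_of_monotone (fun n => (happ_meas n).aemeasurable)
      (ae_of_all _ fun x m n hmn => ?_) (ae_of_all _ fun x => happ_lim _)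
    have h1 : (m : ℝ≥0∞) ≤ n := by exact_mod_cast hmn
    exact mul_le_mul' (htmono.monotone hmn) (min_le_min_left _ h1)
  have hlim2 : Tendsto (fun n : ℕ => (1 - ν.1 univ) * (t n * min (xiInfty μ τ) n)) atTop
      (𝓝 ((1 - ν.1 univ) * xiInfty μ τ)) := by
    by_cases hz : xiInfty μ τ = 0
    · simp [hz]
    · exact ENNReal.Tendsto.const_mul (happ_lim _) (Or.inl hz)
  refine le_of_tendsto' ((tendsto_const_nhds.add hlim1).add hlim2) fun n => ?_
  have h := (key (fun x => (t n * min (xi μ τ x) n).toReal) n (happ_meas n).ennreal_toReal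
    (fun x => ENNReal.toReal_nonneg) (fun x => ?_) (fun x hx => ?_)
    (t n * min (xiInfty μ τ) n).toNNReal ?_).2
  · simpa only [ENNReal.ofReal_toReal (happ_top _ _), ENNReal.coe_toNNReal (happ_top _ _)] using h
  · rw [abs_of_nonneg ENNReal.toReal_nonneg]
    exact ENNReal.toReal_le_of_le_ofReal n.cast_nonneg (by simpa using happ_le _ n)
  · rw [ENNReal.ofReal_toReal (happ_top _ _)]
    exact happ_lt _ _ fun h => hx (by rw [h, ENNReal.toReal_zero])
  · by_cases hz : t n * min (xiInfty μ τ) n = 0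
    · left
      rw [hz, ENNReal.toNNReal_zero]
    · right
      rw [ENNReal.coe_toNNReal (happ_top _ _)]
      exact happ_lt _ _ hz

theorem rateI'_le_iff_dualBound [PolishSpace X] [LocallyCompactSpace X] (hτ : Measurable τ)
    (h0 : ∀ᵐ x ∂μ, τ x ≠ 0) (hfin : ∀ᵐ x ∂μ, τ x ≠ ∞) (hξ : ∀ᵐ x ∂μ, xi μ τ x = ∞)
    {ν : SubProb X} {M : ℝ≥0} : rateI' μ τ ν ≤ M ↔ DualBound μ τ ν.1 M :=
  ⟨dualBound_of_rateI'_le hτ h0 hfin, rateI'_le_of_dualBound hτ h0 hfin hξ⟩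

/-! ### Convexity -/

theorem isConvexFunctional_rateI' [PolishSpace X] [LocallyCompactSpace X] (hτ : Measurable τ)
    (h0 : ∀ᵐ x ∂μ, τ x ≠ 0) (hfin : ∀ᵐ x ∂μ, τ x ≠ ∞) (hξ : ∀ᵐ x ∂μ, xi μ τ x = ∞) :
    IsConvexFunctional (rateI' μ τ) := by
  intro ν₁ ν₂ a b hab
  by_cases ha : a = 0
  · subst ha
    have hb : b = 1 := by simpa using hab
    rw [SubProb.mix_zero_left]
    simp [hb]
  by_cases hb : b = 0
  · subst hb
    have ha : a = 1 := by simpa using hab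
    rw [SubProb.mix_zero_right]
    simp [ha]
  by_cases hI1 : rateI' μ τ ν₁ = ∞
  · simp [hI1, ENNReal.mul_top (ENNReal.coe_ne_zero.2 ha)]
  by_cases hI2 : rateI' μ τ ν₂ = ∞
  · simp [hI2, ENNReal.mul_top (ENNReal.coe_ne_zero.2 hb)]
  lift rateI' μ τ ν₁ to ℝ≥0 using hI1 with M₁ hM₁
  lift rateI' μ τ ν₂ to ℝ≥0 using hI2 with M₂ hM₂
  have h := (dualBound_of_rateI'_le hτ h0 hfin hM₁.ge).mix
    (dualBound_of_rateI'_le hτ h0 hfin hM₂.ge) a b hab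
  exact_mod_cast rateI'_le_of_dualBound (M := a * M₁ + b * M₂) hτ h0 hfin hξ
    (by exact_mod_cast h)

end Duality

/-! ### Finiteness somewhere -/

section Finiteness

open InformationTheory

/-- The functional `rateI'` is finite at the probability measure proportional to
`τ 1_{τ ≤ n} dμ`, for which the tilted measure is `μ` conditioned on `{τ ≤ n}`. -/
theorem exists_rateI'_ne_top {X : Type*} [MetricSpace X] [MeasurableSpace X] {μ : Measure X}
    [IsProbabilityMeasure μ] {τ : X → ℝ≥0∞} (hτ : Measurable τ) (h0 : ∀ᵐ x ∂μ, τ x ≠ 0)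
    (hfin : ∀ᵐ x ∂μ, τ x ≠ ∞) : ∃ ν : SubProb X, rateI' μ τ ν ≠ ∞ := by
  have hAm : ∀ n : ℕ, MeasurableSet {x | τ x ≤ n} := fun n => measurableSet_le hτ measurable_const
  obtain ⟨n, hn⟩ : ∃ n : ℕ, μ {x | τ x ≤ n} ≠ 0 := by
    by_contra! h
    have hU : μ (⋃ n : ℕ, {x | τ x ≤ n}) = 0 := measure_iUnion_null h
    have hU' : μ (⋃ n : ℕ, {x | τ x ≤ n})ᶜ = 0 := by
      change ∀ᵐ x ∂μ, x ∈ ⋃ n : ℕ, {x | τ x ≤ n}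
      filter_upwards [hfin] with x hx
      obtain ⟨k, hk⟩ := ENNReal.exists_nat_gt hx
      exact mem_iUnion.2 ⟨k, hk.le⟩
    have h1 := measure_univ_le_add_compl (μ := μ) (⋃ n : ℕ, {x | τ x ≤ n})
    rw [hU, hU', measure_univ] at h1
    simp at h1
  set A : Set X := {x | τ x ≤ n}
  have hA : MeasurableSet A := hAm n
  set s : ℝ≥0∞ := ∫⁻ x in A, τ x ∂μ
  have hs0 : s ≠ 0 := by
    intro h
    have h1 : ∀ᵐ x ∂(μ.restrict A), τ x = 0 := (lintegral_eq_zero_iff hτ).1 h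
    have h2 : μ.restrict A = 0 := by
      rw [← Measure.measure_univ_eq_zero, ← compl_empty]
      change ∀ᵐ x ∂(μ.restrict A), x ∈ (∅ : Set X)
      filter_upwards [h1, ae_restrict_of_ae h0] with x hx hx' using hx' hx
    exact hn (Measure.restrict_eq_zero.1 h2)
  have hs_fin : s ≠ ∞ := by
    refine ((setLIntegral_mono' (g := fun _ => (n : ℝ≥0∞)) hA fun x hx => hx).trans_lt ?_).ne
    rw [setLIntegral_const]
    exact ENNReal.mul_lt_top (ENNReal.natCast_lt_top n) (measure_lt_top _ _)
  set d : X → ℝ≥0∞ := A.indicator fun x => s⁻¹ * τ x with hd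
  have hdm : Measurable d := (hτ.const_mul _).indicator hA
  have hmass : μ.withDensity d univ = 1 := by
    rw [withDensity_apply _ MeasurableSet.univ, Measure.restrict_univ, hd,
      lintegral_indicator hA, lintegral_const_mul _ hτ]
    exact ENNReal.inv_mul_cancel hs0 hs_fin
  obtain ⟨ν, hν⟩ : ∃ ν : SubProb X, ν.1 = μ.withDensity d := ⟨⟨_, hmass.le⟩, rfl⟩
  refine ⟨ν, ?_⟩
  have hfinm : IsFiniteMeasure (μ.withDensity d) := ⟨by rw [hmass]; exact ENNReal.one_lt_top⟩
  have hacp : acPart (μ.withDensity d) μ = μ.withDensity d :=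
    Measure.withDensity_rnDeriv_eq _ _ (withDensity_absolutelyContinuous _ _)
  have hsing : (μ.withDensity d).singularPart μ = 0 :=
    Measure.singularPart_eq_zero_of_ac (withDensity_absolutelyContinuous _ _)
  have hdτ : (μ.withDensity d).withDensity (fun x => (τ x)⁻¹) = s⁻¹ • μ.restrict A := by
    rw [← withDensity_mul (g := fun x => (τ x)⁻¹) _ hdm hτ.inv, ← withDensity_indicator_one hA, ← withDensity_smul _
      (measurable_one.indicator hA)]
    refine withDensity_congr_ae ?_
    filter_upwards [h0, hfin] with x hx hx'
    by_cases hxA : x ∈ A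
    · simp only [hd, Pi.mul_apply, Pi.smul_apply, indicator_of_mem hxA, Pi.one_apply, smul_eq_mul]
      rw [mul_assoc]
      congr 1
      exact ENNReal.mul_inv_cancel hx hx'
    · simp only [hd, Pi.mul_apply, Pi.smul_apply, indicator_of_notMem hxA, zero_mul, smul_zero]
  have hinv : invTau τ (μ.withDensity d) = s⁻¹ * μ A := by
    have h : invTau τ (μ.withDensity d) =
        (μ.withDensity d).withDensity (fun x => (τ x)⁻¹) univ := by
      rw [withDensity_apply _ MeasurableSet.univ, Measure.restrict_univ, invTau]
    rw [h, hdτ, Measure.smul_apply, Measure.restrict_apply_univ, smul_eq_mul]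
  have hinv_fin : invTau τ (μ.withDensity d) < ∞ := by
    rw [hinv]
    exact ENNReal.mul_lt_top (ENNReal.inv_lt_top.2 (pos_iff_ne_zero.2 hs0)) (measure_lt_top _ _)
  have htilt : tilt τ (μ.withDensity d) = (μ A)⁻¹ • μ.restrict A := by
    rw [tilt, hdτ, hinv, smul_smul, ENNReal.mul_inv (Or.inr (measure_ne_top _ _)) (Or.inr hn),
      inv_inv, mul_comm s, mul_assoc, ENNReal.mul_inv_cancel hs0 hs_fin, mul_one]
  have hkl : klDiv ((μ A)⁻¹ • μ.restrict A) μ ≠ ∞ := by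
    have hac : (μ A)⁻¹ • μ.restrict A = μ.withDensity (A.indicator fun _ => (μ A)⁻¹) := by
      rw [withDensity_indicator hA, withDensity_const]
    have : IsFiniteMeasure ((μ A)⁻¹ • μ.restrict A) := (μ.restrict A).smul_finite
      (ENNReal.inv_ne_top.2 hn)
    refine klDiv_ne_top (Measure.restrict_le_self.absolutelyContinuous.smul_left _) ?_
    have hllr : llr ((μ A)⁻¹ • μ.restrict A) μ =ᵐ[(μ A)⁻¹ • μ.restrict A]
        fun _ => Real.log ((μ A)⁻¹).toReal := by
      have h1 : ((μ A)⁻¹ • μ.restrict A).rnDeriv μ =ᵐ[μ] A.indicator fun _ => (μ A)⁻¹ := by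
        rw [hac]
        exact Measure.rnDeriv_withDensity _ (measurable_const.indicator hA)
      refine Measure.AbsolutelyContinuous.ae_le (Measure.smul_absolutelyContinuous) ?_
      filter_upwards [ae_restrict_of_ae h1, ae_restrict_mem hA] with x hx hxA
      rw [llr, hx, indicator_of_mem hxA]
    exact (integrable_const _).congr hllr.symm
  rw [rateI', hν, hacp, if_pos hinv_fin, hsing, hmass, htilt, tsub_self, zero_mul, add_zero,
    lintegral_zero_measure, add_zero]
  exact ENNReal.mul_ne_top hinv_fin.ne hkl

end Finiteness

end RenewalLD

theorem proposition1p4 {X : Type*} [MetricSpace X] [PolishSpace X] [LocallyCompactSpace X]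
    [MeasurableSpace X] [BorelSpace X]
    (μ : Measure X) [IsProbabilityMeasure μ]
    (τ : X → ℝ≥0∞) (hτ : Measurable τ)
    (hA1 : μ {x | τ x = 0} = 0 ∧ μ {x | τ x = ∞} = 0)
    (hA2 : μ {x | RenewalLD.xi μ τ x < ∞} = 0) :
    RenewalLD.IsGood (RenewalLD.rateI' μ τ) ∧
      RenewalLD.IsConvexFunctional (RenewalLD.rateI' μ τ) := by
  have h0 : ∀ᵐ x ∂μ, τ x ≠ 0 := measure_eq_zero_iff_ae_notMem.1 hA1.1
  have hfin : ∀ᵐ x ∂μ, τ x ≠ ∞ := measure_eq_zero_iff_ae_notMem.1 hA1.2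
  have hξ : ∀ᵐ x ∂μ, RenewalLD.xi μ τ x = ∞ :=
    (measure_eq_zero_iff_ae_notMem.1 hA2).mono fun x hx => not_lt_top_iff.1 hx
  refine ⟨⟨fun M _ => ?_, RenewalLD.exists_rateI'_ne_top hτ h0 hfin⟩,
    RenewalLD.isConvexFunctional_rateI' hτ h0 hfin hξ⟩
  simp only [RenewalLD.rateI'_le_iff_dualBound hτ h0 hfin hξ]
  exact (RenewalLD.isClosed_setOf_dualBound _).isCompact
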